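/- Identify $\{0,1\}^n$ with $\mathbb{F}_2^n$. An induced system of linear equations is a pair $(M,\sigma)$, where $M$ is an $m\times k$ matrix over $\mathbb{F}_2$ and $\sigma\in\{0,1\}^k$. A function $f:\mathbb{F}_2^n\to\{0,1\}$ is $(M,\sigma)$-free if there is no $x=(x_1,\dots,x_k)\in(\mathbb{F}_2^n)^k$ such that $Mx=0$ and $f(x_j)=\sigma_j$ for all $1\le j\le k$. For a set $\mathcal{F}$ of induced systems, $f$ is $\mathcal{F}$-free if it is $(M,\sigma)$-free for every $(M,\sigma)\in\mathcal{F}$. Two functions $f,g:\mathbb{F}_2^n\to\{0,1\}$ are $\varepsilon$-far if they differ on at least $\varepsilon 2^n$ inputs, and $f$ is $\varepsilon$-far from a property $\mathcal{P}=\bigcup_n\mathcal{P}_n$ (where $\mathcal{P}_n$ is a set of functions $\mathbb{F}_2^n\to\{0,1\}$) if it is $\varepsilon$-far from every $g\in\mathcal{P}_n$. The property $\mathcal{P}$ is testable with one-sided error if there are a function $q:(0,\infty)\to\mathbb{N}$ and a randomized (possibly adaptive) query algorithm which, given $\varepsilon>0$, $n\ge 0$ and oracle access to $f:\mathbb{F}_2^n\to\{0,1\}$,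 makes at most $q(\varepsilon)$ queries to $f$, accepts with probability $1$ if $f\in\mathcal{P}_n$, and rejects with probability at least $2/3$ if $f$ is $\varepsilon$-far from $\mathcal{P}$. Here a randomized query algorithm is, for each $\varepsilon$ and $n$, a probability distribution on deterministic decision trees whose nodes query values of $f$; only the number of queries is counted. **Theorem.** Let $\mathcal{F}=\{(M^1,\sigma^1),(M^2,\sigma^2),\dots\}$ be a possibly infinite set of induced equations (that is, every matrix $M^i$ has rank one), each on more than two variables (that is, more than two columns of $M^i$ are nonzero). Then the property of being $\mathcal{F}$-free is testable with one-sided error. -/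

import Mathlib

/-- The domain `F_2^n`. -/
abbrev Cube (n : ℕ) : Type := Fin n → ZMod 2

/-- Boolean functions on `F_2^n` (`true` stands for `1`, `false` for `0`). -/
abbrev BoolFun (n : ℕ) : Type := Cube n → Bool

/-- A property of Boolean functions: for each `n`, a set of functions on `F_2^n`. -/
abbrev BoolProperty : Type := (n : ℕ) → Set (BoolFun n)

/-- A (forbidden) induced system of linear equations `(M, σ)`: an `m × k` matrix over `F_2`
and a pattern `σ ∈ {0,1}^k`. -/
structure InducedSystem where
  m : ℕ
  k : ℕ
  M : Matrix (Fin m) (Fin k) (ZMod 2)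
  σ : Fin k → Bool

namespace InducedSystem

/-- `f` induces `(M, σ)` at `x = (x_1, …, x_k)`: `M x = 0` and `f (x_j) = σ_j` for all `j`. -/
def InducedAt (S : InducedSystem) {n : ℕ} (f : BoolFun n) (x : Fin S.k → Cube n) : Prop :=
  (∀ i, ∑ j, S.M i j • x j = 0) ∧ ∀ j, f (x j) = S.σ j

/-- `f` is `(M, σ)`-free. -/
def IsFree (S : InducedSystem) {n : ℕ} (f : BoolFun n) : Prop :=
  ¬ ∃ x : Fin S.k → Cube n, S.InducedAt f x

/-- The (indices of the) variables that occur in the system with a nonzero coefficient. -/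
def occurring (S : InducedSystem) : Set (Fin S.k) := {j | ∃ i, S.M i j ≠ 0}

/-- The system amounts to a single equation (`M` has rank one), on more than two variables. -/
def IsSingleEquation (S : InducedSystem) : Prop :=
  S.M.rank = 1 ∧ 2 < S.occurring.ncard

end InducedSystem

/-- The property of being `F`-free. -/
def familyFree (F : Set InducedSystem) : BoolProperty :=
  fun _ => {f | ∀ S ∈ F, S.IsFree f}

/-- `f` and `g` are `ε`-far: they differ on at least `ε 2^n` inputs. -/
def IsFar (ε : ℝ) {n : ℕ} (f g : BoolFun n) : Prop :=
  ε * 2 ^ n ≤ (({x | f x ≠ g x} : Set (Cube n)).ncard : ℝ)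

/-- `f` is `ε`-far from satisfying `P`: it is `ε`-far from every function satisfying `P`. -/
def IsFarFrom (ε : ℝ) (P : BoolProperty) {n : ℕ} (f : BoolFun n) : Prop :=
  ∀ g ∈ P n, IsFar ε f g

/-- A deterministic (adaptive) oracle algorithm on functions on `F_2^n`: a decision tree that
either stops and accepts (`true`) or rejects (`false`), or queries the oracle at a point and
continues according to the answer. -/
inductive QueryAlg (n : ℕ) : Type where
  | answer (accept : Bool) : QueryAlg n
  | query (x : Cube n) (next : Bool → QueryAlg n) : QueryAlg n

namespace QueryAlg

/-- The verdict on oracle `f`; `true` means that `f` is accepted. -/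
def run {n : ℕ} : QueryAlg n → BoolFun n → Bool
  | answer b, _ => b
  | query x next, f => (next (f x)).run f

/-- The number of queries made on oracle `f`. -/
def numQueries {n : ℕ} : QueryAlg n → BoolFun n → ℕ
  | answer _, _ => 0
  | query x next, f => (next (f x)).numQueries f + 1

end QueryAlg

/-- A randomized oracle algorithm: a probability distribution on deterministic ones. -/
abbrev RandQueryAlg (n : ℕ) : Type := PMF (QueryAlg n)

namespace RandQueryAlg

/-- For every oracle and every outcome of the coins at most `q` queries are made. -/
def QueriesAtMost {n : ℕ} (T : RandQueryAlg n) (q : ℕ) : Prop :=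
  ∀ A ∈ T.support, ∀ f : BoolFun n, A.numQueries f ≤ q

/-- The probability that `T` accepts the oracle `f`. -/
noncomputable def acceptProb {n : ℕ} (T : RandQueryAlg n) (f : BoolFun n) : ENNReal :=
  T.map (fun A => A.run f) true

/-- The probability that `T` rejects the oracle `f`. -/
noncomputable def rejectProb {n : ℕ} (T : RandQueryAlg n) (f : BoolFun n) : ENNReal :=
  T.map (fun A => A.run f) false

end RandQueryAlg

/-- `P` is testable with one-sided error: there is a tester `T`, given `ε` and `n` and oracle
access to `f : F_2^n → {0,1}`, such that the number of queries is bounded by a constant depending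
on `ε` but not on `n`, every `f` satisfying `P` is accepted with probability `1`, and every `f`
that is `ε`-far from satisfying `P` is rejected with probability at least `2/3`. -/
def IsTestableOneSided (P : BoolProperty) : Prop :=
  ∃ (q : ℝ → ℕ) (T : ℝ → (n : ℕ) → RandQueryAlg n), ∀ ε : ℝ, 0 < ε → ∀ n : ℕ,
    RandQueryAlg.QueriesAtMost (T ε n) (q ε) ∧
    (∀ f ∈ P n, RandQueryAlg.acceptProb (T ε n) f = 1) ∧
    ∀ f : BoolFun n, IsFarFrom ε P f → 2 / 3 ≤ RandQueryAlg.rejectProb (T ε n) f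

/-!
Since `F`-freeness passes to pullbacks along linear maps `F_2^q → F_2^n`, a tester may restrict `f`
to the span of a random `q`-tuple and reject iff the restriction is not `F`-free; it never rejects
an `F`-free function (`isTestableOneSided_of_rejects`). The content is therefore `exists_rejects`:
if `f` is `ε`-far from `F`-free, then for some `q = q(ε)` a random `q`-tuple spans a violation with
probability bounded below in terms of `ε`.

A rank-one system over `F_2` says that the occurring variables sum to zero, so only the pattern
matters. Three facts carry the proof.

* If `f` is close enough to `g ∘ ψ`, with `ψ` a linear map to `F_2^c` and `c` bounded, then `f` is
  rejected (`eventually_rejects_of_near_junta`): `g ∘ ψ` cannot be `F`-free, and most of the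
  solutions in the fibres of `ψ` are solutions for `f` too. This covers nearly constant functions.

* Suppose that all occurring variables of all patterns carry the same value `v`. Fourier regularity
  relative to the fibres of some `ψ` of bounded codimension lets one delete a small part of
  `f⁻¹(v)` such that what is left lives in fibres where `f⁻¹(v)` is dense and regular. Deleting
  points of `f⁻¹(v)` creates no solutions among the occurring variables, hence some system of `F`
  has a solution in the set `Y` of good fibres, and counting lifts it to many solutions for `f`
  (`eventually_rejects_of_same_value`). There are finitely many sets `Y ⊆ F_2^c`, so finitely many
  systems of `F` suffice for a given `ε`, although `F` may be infinite. The count needs three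
  occurring variables.

* Otherwise one of the classes `h⁻¹(v)` of every nonconstant `F`-free `h` is closed under sums of
  three elements, by a parity analysis of the patterns (`exists_closedUnderTriples`). Either `f` has
  many triples violating this, and random `3`-tuples detect it, or `f⁻¹(v)` is nearly closed and
  thus close to an affine subspace of bounded codimension (`exists_affine_of_card_badTriples_le`),
  so that the first fact applies.

Bounds are stated as `∀ᶠ q in atTop`, because this makes it immediate to merge finitely many cases.
-/

namespace LinearInvariant

open Finset Filter
open scoped Classical
open scoped Pointwise

/-! ### Restriction to random subspaces -/

/-- The linear map `F_2^d → F_2^n` that sends the standard basis to `φ`. -/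
def linComb {n d : ℕ} (φ : Fin d → Cube n) (v : Cube d) : Cube n := ∑ i, v i • φ i

/-- The pullback of `f` along `linComb φ`: the restriction of `f` to the span of `φ`,
parametrized by coefficient vectors. -/
def pull {n d : ℕ} (f : BoolFun n) (φ : Fin d → Cube n) : BoolFun d := fun v => f (linComb φ v)

lemma linComb_sum {n d : ℕ} (φ : Fin d → Cube n) {ι : Type*} (s : Finset ι) (g : ι → Cube d)
    (c : ι → ZMod 2) : linComb φ (∑ j ∈ s, c j • g j) = ∑ j ∈ s, c j • linComb φ (g j) := by
  simp only [linComb, Finset.sum_apply, Pi.smul_apply, smul_eq_mul, Finset.sum_smul,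
    Finset.smul_sum]
  rw [Finset.sum_comm]
  simp only [mul_smul]

lemma linComb_add {n d : ℕ} (φ : Fin d → Cube n) (v w : Cube d) :
    linComb φ (v + w) = linComb φ v + linComb φ w := by
  simp [linComb, add_smul, Finset.sum_add_distrib]

lemma linComb_zero {n d : ℕ} (φ : Fin d → Cube n) : linComb φ 0 = 0 := by
  simp [linComb]

lemma linComb_single {n d : ℕ} (φ : Fin d → Cube n) (i : Fin d) :
    linComb φ (Pi.single i 1) = φ i := by
  simp [linComb, Pi.single_apply]

lemma pull_mem_familyFree {F : Set InducedSystem} {n d : ℕ} {f : BoolFun n}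
    (hf : f ∈ familyFree F n) (φ : Fin d → Cube n) : pull f φ ∈ familyFree F d := by
  rintro S hS ⟨x, hx, hσ⟩
  refine hf S hS ⟨fun j => linComb φ (x j), fun i => ?_, hσ⟩
  rw [← linComb_sum, hx i, linComb_zero]

/-- The fraction of the tuples `φ ∈ (F_2^n)^d` for which the restriction of `f` to the span of
`φ` is not `F`-free. -/
noncomputable def rejFrac (F : Set InducedSystem) (d : ℕ) {n : ℕ} (f : BoolFun n) : ℝ :=
  (#{φ : Fin d → Cube n | pull f φ ∉ familyFree F d} : ℝ) / ((2 : ℝ) ^ n) ^ d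

lemma card_cube (n : ℕ) : Fintype.card (Cube n) = 2 ^ n := by simp [ZMod.card]

lemma card_tuple (n d : ℕ) : Fintype.card (Fin d → Cube n) = (2 ^ n) ^ d := by
  rw [Fintype.card_fun, card_cube, Fintype.card_fin]

lemma rejFrac_le_succ (F : Set InducedSystem) (d : ℕ) {n : ℕ} (f : BoolFun n) :
    rejFrac F d f ≤ rejFrac F (d + 1) f := by
  have hN : (0 : ℝ) < 2 ^ n := by positivity
  have key : #{φ : Fin d → Cube n | pull f φ ∉ familyFree F d} * 2 ^ n ≤
      #{φ : Fin (d + 1) → Cube n | pull f φ ∉ familyFree F (d + 1)} := by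
    rw [← card_cube, ← Finset.card_univ, ← Finset.card_product]
    refine Finset.card_le_card_of_injOn (fun p => Fin.snoc (α := fun _ => Cube n) p.1 p.2) ?_ ?_
    · rintro ⟨φ, u⟩ h
      simp only [coe_product, coe_filter, mem_univ, true_and, Set.mem_prod,
        Set.mem_ofPred_eq] at h ⊢
      intro hf
      apply h.1
      have := pull_mem_familyFree hf (fun i : Fin d => Pi.single (Fin.castSucc i) 1)
      convert this using 1
      funext v
      have e : linComb (fun i : Fin d => (Pi.single (Fin.castSucc i) 1 : Cube (d + 1))) v
          = Fin.snoc (α := fun _ => ZMod 2) v 0 := by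
        funext j
        refine Fin.lastCases ?_ (fun j => ?_) j
        · simp [linComb, Finset.sum_apply, Fin.castSucc_ne_last, eq_comm]
        · simp [linComb, Finset.sum_apply, Pi.single_apply]
      simp only [pull, e]
      simp [linComb, Fin.sum_univ_castSucc]
    · rintro ⟨φ, u⟩ - ⟨φ', u'⟩ - h
      have := Fin.snoc_injective2 h
      exact Prod.ext this.1 this.2
  unfold rejFrac
  rw [div_le_div_iff₀ (by positivity) (by positivity), pow_succ]
  have : ((#{φ : Fin d → Cube n | pull f φ ∉ familyFree F d} : ℝ)) * 2 ^ n ≤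
      #{φ : Fin (d + 1) → Cube n | pull f φ ∉ familyFree F (d + 1)} := by exact_mod_cast key
  calc _ = ((#{φ : Fin d → Cube n | pull f φ ∉ familyFree F d} : ℝ)) * 2 ^ n * (2 ^ n) ^ d := by
        ring
    _ ≤ _ := by gcongr

lemma rejFrac_mono (F : Set InducedSystem) {d e : ℕ} (h : d ≤ e) {n : ℕ} (f : BoolFun n) :
    rejFrac F d f ≤ rejFrac F e f :=
  monotone_nat_of_le_succ (fun d => rejFrac_le_succ F d f) h

/-- A random `q`-tuple detects with probability at least `1 / (q + 1)` that `f` is not `F`-free.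
The parameter `q` bounds both the dimension and the probability, so that the notion is monotone
in `q` and finitely many cases can be merged with `Filter.eventually_all`. -/
def Rejects (F : Set InducedSystem) (q : ℕ) {n : ℕ} (f : BoolFun n) : Prop :=
  1 / ((q : ℝ) + 1) ≤ rejFrac F q f

lemma Rejects.mono {F : Set InducedSystem} {q r : ℕ} (h : q ≤ r) {n : ℕ} {f : BoolFun n}
    (hf : Rejects F q f) : Rejects F r f := by
  have h' : (q : ℝ) ≤ r := by exact_mod_cast h
  refine le_trans ?_ (hf.trans (rejFrac_mono F h f))
  gcongr

lemma eventually_rejects (F : Set InducedSystem) (d : ℕ) {δ : ℝ} (hδ : 0 < δ) :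
    ∀ᶠ q : ℕ in atTop, ∀ (n : ℕ) (f : BoolFun n), δ ≤ rejFrac F d f → Rejects F q f := by
  have h1 : ∀ᶠ q : ℕ in atTop, 1 / ((q : ℝ) + 1) < δ :=
    tendsto_one_div_add_atTop_nhds_zero_nat.eventually_lt_const hδ
  filter_upwards [h1, eventually_ge_atTop d] with q hq hd n f hf
  exact (hq.le.trans hf).trans (rejFrac_mono F hd f)

/-! ### From rejection by random restrictions to a tester -/

/-- Query all points of a list, record the answers on top of `acc`, and output the value of `D`
at the resulting function. -/
noncomputable def queryAll {n : ℕ} : List (Cube n) → BoolFun n → (BoolFun n → Bool) → QueryAlg n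
  | [], acc, D => .answer (D acc)
  | x :: L, acc, D => .query x fun b => queryAll L (Function.update acc x b) D

lemma numQueries_queryAll {n : ℕ} (L : List (Cube n)) (acc : BoolFun n) (D : BoolFun n → Bool)
    (f : BoolFun n) : (queryAll L acc D).numQueries f = L.length := by
  induction L generalizing acc with
  | nil => rfl
  | cons x L ih => simp [queryAll, QueryAlg.numQueries, ih]

lemma run_queryAll {n : ℕ} (L : List (Cube n)) (acc : BoolFun n) (D : BoolFun n → Bool)
    (f : BoolFun n) :
    (queryAll L acc D).run f = D (fun x => if x ∈ L then f x else acc x) := by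
  induction L generalizing acc with
  | nil => simp [queryAll, QueryAlg.run]
  | cons x L ih =>
    simp only [queryAll, QueryAlg.run, ih]
    congr 1
    funext z
    by_cases hz : z = x
    · subst hz; simp
    · simp [hz]

/-- The deterministic algorithm that reads `f` on the spans of the tuples `Φ 0, …, Φ (t - 1)` and
accepts iff all these restrictions are `F`-free. -/
noncomputable def spanAlg (F : Set InducedSystem) {n t q : ℕ} (Φ : Fin t → Fin q → Cube n) :
    QueryAlg n :=
  queryAll ((univ : Finset (Fin t × Cube q)).toList.map fun p => linComb (Φ p.1) p.2)
    (fun _ => false) fun f => decide (∀ i, pull f (Φ i) ∈ familyFree F q)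

lemma run_spanAlg (F : Set InducedSystem) {n t q : ℕ} (Φ : Fin t → Fin q → Cube n)
    (f : BoolFun n) :
    (spanAlg F Φ).run f = decide (∀ i, pull f (Φ i) ∈ familyFree F q) := by
  rw [spanAlg, run_queryAll]
  congr 1
  refine propext (forall_congr' fun i => ?_)
  have : (pull (fun x => if x ∈ (univ : Finset (Fin t × Cube q)).toList.map
      (fun p => linComb (Φ p.1) p.2) then f x else false) (Φ i)) = pull f (Φ i) := by
    funext v
    simp only [pull]
    rw [if_pos]
    simp only [List.mem_map, mem_toList, mem_univ, true_and, Prod.exists]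
    exact ⟨i, v, rfl⟩
  rw [this]

lemma numQueries_spanAlg (F : Set InducedSystem) {n t q : ℕ} (Φ : Fin t → Fin q → Cube n)
    (f : BoolFun n) : (spanAlg F Φ).numQueries f = t * 2 ^ q := by
  rw [spanAlg, numQueries_queryAll]
  simp

/-- Run `spanAlg` on `t` independent uniformly random `q`-tuples. -/
noncomputable def spanTester (F : Set InducedSystem) (t q n : ℕ) : RandQueryAlg n :=
  (PMF.uniformOfFintype (Fin t → Fin q → Cube n)).map (spanAlg F)

lemma map_spanTester_apply (F : Set InducedSystem) (t q n : ℕ) (f : BoolFun n) (b : Bool) :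
    (spanTester F t q n).map (fun A => A.run f) b =
      (#{Φ : Fin t → Fin q → Cube n | (spanAlg F Φ).run f = b} : ENNReal) /
        Fintype.card (Fin t → Fin q → Cube n) := by
  rw [spanTester, PMF.map_comp, ← PMF.toOuterMeasure_apply_singleton,
    PMF.toOuterMeasure_map_apply, PMF.toOuterMeasure_uniformOfFintype_apply]
  congr 2
  rw [Fintype.card_subtype]
  congr 1
  ext Φ
  simp

lemma acceptProb_spanTester (F : Set InducedSystem) (t q n : ℕ) {f : BoolFun n}
    (hf : f ∈ familyFree F n) : RandQueryAlg.acceptProb (spanTester F t q n) f = 1 := by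
  rw [RandQueryAlg.acceptProb, map_spanTester_apply]
  rw [Finset.filter_true_of_mem, Finset.card_univ]
  · exact ENNReal.div_self (by simp) (by simp)
  · intro Φ _
    rw [run_spanAlg, decide_eq_true_iff]
    exact fun i => pull_mem_familyFree hf _

lemma rejectProb_spanTester (F : Set InducedSystem) {t q n : ℕ} {f : BoolFun n}
    (hf : Rejects F q f) (ht : (1 - 1 / ((q : ℝ) + 1)) ^ t ≤ 1 / 3) :
    2 / 3 ≤ RandQueryAlg.rejectProb (spanTester F t q n) f := by
  rw [RandQueryAlg.rejectProb, map_spanTester_apply]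
  set B : Finset (Fin q → Cube n) := {φ | pull f φ ∉ familyFree F q} with hB
  set M : ℕ := Fintype.card (Fin q → Cube n) with hM
  have hMpos : (0 : ℝ) < M := by rw [hM]; exact_mod_cast Fintype.card_pos
  have hBM : #B + #Bᶜ = M := by rw [Finset.card_add_card_compl]
  have hgood : (Finset.univ.filter fun Φ : Fin t → Fin q → Cube n => (spanAlg F Φ).run f = false)
      = (Fintype.piFinset fun _ : Fin t => Bᶜ)ᶜ := by
    ext Φ
    simp [run_spanAlg, hB]
  have hle : (Bᶜ).card ≤ (1 - 1 / ((q : ℝ) + 1)) * M := by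
    have h1 : 1 / ((q : ℝ) + 1) ≤ #B / M := by
      have := hf
      unfold Rejects rejFrac at this
      rw [hM, card_tuple]
      push_cast
      exact this
    rw [le_div_iff₀ hMpos] at h1
    have : (#B : ℝ) + (Bᶜ).card = M := by exact_mod_cast hBM
    linarith
  have hcard : Fintype.card (Fin t → Fin q → Cube n) = M ^ t := by simp [hM]
  have hsum : (Fintype.piFinset fun _ : Fin t => Bᶜ).card +
      ((Fintype.piFinset fun _ : Fin t => Bᶜ)ᶜ).card = M ^ t := by
    rw [Finset.card_add_card_compl, hcard]
  have hpi : (Fintype.piFinset fun _ : Fin t => Bᶜ).card = (Bᶜ).card ^ t := by simp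
  have hreal : (2 : ℝ) * (M : ℝ) ^ t ≤ 3 * ((Fintype.piFinset fun _ : Fin t => Bᶜ)ᶜ).card := by
    have e : (((Bᶜ).card : ℝ)) ^ t + ((Fintype.piFinset fun _ : Fin t => Bᶜ)ᶜ).card
        = (M : ℝ) ^ t := by
      rw [hpi] at hsum
      exact_mod_cast hsum
    have h2 : (((Bᶜ).card : ℝ)) ^ t ≤ 1 / 3 * (M : ℝ) ^ t :=
      calc (((Bᶜ).card : ℝ)) ^ t ≤ ((1 - 1 / ((q : ℝ) + 1)) * M) ^ t := by gcongr
        _ = (1 - 1 / ((q : ℝ) + 1)) ^ t * (M : ℝ) ^ t := mul_pow _ _ _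
        _ ≤ _ := by gcongr
    linarith
  have hnat : 2 * M ^ t ≤ 3 * ((Fintype.piFinset fun _ : Fin t => Bᶜ)ᶜ).card := by
    exact_mod_cast hreal
  rw [hgood, hcard]
  have hM0 : ((M ^ t : ℕ) : ENNReal) ≠ 0 := by
    have : 0 < M := by exact_mod_cast hMpos
    exact_mod_cast (pow_pos this t).ne'
  rw [ENNReal.div_le_iff_le_mul (by simp) (by simp), mul_comm,
    ← mul_div_assoc, ENNReal.le_div_iff_mul_le (Or.inl hM0) (Or.inl (by simp))]
  exact_mod_cast hnat

/-- One-sided testability follows once every `ε`-far function is detected by random restrictions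
to a space of bounded dimension: `F`-freeness passes to restrictions, so accepting is never wrong,
and repetition amplifies the detection probability. -/
theorem isTestableOneSided_of_rejects (F : Set InducedSystem)
    (h : ∀ ε : ℝ, 0 < ε → ∃ q : ℕ, ∀ (n : ℕ) (f : BoolFun n),
      IsFarFrom ε (familyFree F) f → Rejects F q f) :
    IsTestableOneSided (familyFree F) := by
  have h' : ∀ ε : ℝ, ∃ q : ℕ, 0 < ε → ∀ (n : ℕ) (f : BoolFun n),
      IsFarFrom ε (familyFree F) f → Rejects F q f := fun ε => by
    by_cases hε : 0 < ε
    · obtain ⟨q, hq⟩ := h ε hε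
      exact ⟨q, fun _ => hq⟩
    · exact ⟨0, fun h => absurd h hε⟩
  choose q hq using h'
  have ht : ∀ ε : ℝ, ∃ t : ℕ, (1 - 1 / ((q ε : ℝ) + 1)) ^ t ≤ 1 / 3 := fun ε => by
    have h1 : 1 / ((q ε : ℝ) + 1) ≤ 1 := by
      rw [div_le_one (by positivity)]; linarith [(Nat.cast_nonneg (q ε) : (0:ℝ) ≤ q ε)]
    have h2 : 0 < 1 / ((q ε : ℝ) + 1) := by positivity
    obtain ⟨t, ht⟩ := exists_pow_lt_of_lt_one (show (0 : ℝ) < 1 / 3 by norm_num)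
      (show 1 - 1 / ((q ε : ℝ) + 1) < 1 by linarith)
    exact ⟨t, ht.le⟩
  choose t ht using ht
  refine ⟨fun ε => t ε * 2 ^ q ε, fun ε n => spanTester F (t ε) (q ε) n, fun ε hε n => ⟨?_, ?_, ?_⟩⟩
  · intro A hA f
    obtain ⟨Φ, -, rfl⟩ := (PMF.mem_support_map_iff _ _ _).1 hA
    exact (numQueries_spanAlg F Φ f).le
  · exact fun f hf => acceptProb_spanTester F _ _ _ hf
  · exact fun f hf => rejectProb_spanTester F (hq ε hε n f hf) (ht ε)

/-! ### Systems of rank one -/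

/-- The set of variables that occur in the system, as a finset. -/
noncomputable def occ (S : InducedSystem) : Finset (Fin S.k) := {j | j ∈ S.occurring}

lemma mem_occ {S : InducedSystem} {j : Fin S.k} : j ∈ occ S ↔ ∃ i, S.M i j ≠ 0 := by
  rw [occ, Finset.mem_filter]
  exact ⟨fun h => h.2, fun h => ⟨mem_univ _, h⟩⟩

lemma two_lt_card_occ {S : InducedSystem} (hS : S.IsSingleEquation) : 2 < #(occ S) := by
  have := hS.2
  rwa [Set.ncard_eq_toFinset_card', show S.occurring.toFinset = occ S by ext; simp [occ]] at this

lemma zmod_two_eq_one {a : ZMod 2} (h : a ≠ 0) : a = 1 := by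
  revert a; decide

/-- Over `F_2` a rank-one matrix has a row that is the indicator of the occurring variables, and
every other row is zero or equal to it. -/
lemma exists_row {S : InducedSystem} (hS : S.IsSingleEquation) :
    ∃ i₀, (∀ j, S.M i₀ j = if j ∈ occ S then 1 else 0) ∧ ∀ i, S.M i = 0 ∨ S.M i = S.M i₀ := by
  have hrank := hS.1
  rw [Matrix.rank_eq_finrank_span_row] at hrank
  obtain ⟨w, -, hw⟩ := finrank_eq_one_iff'.1 hrank
  have hrow : ∀ i, S.M i = 0 ∨ S.M i = w := fun i => by
    obtain ⟨c, hc⟩ := hw ⟨S.M i, Submodule.subset_span ⟨i, rfl⟩⟩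
    have hc' : c • (w : Fin S.k → ZMod 2) = S.M i := congrArg Subtype.val hc
    by_cases h0 : c = 0
    · left; rw [← hc', h0, zero_smul]
    · right; rw [← hc', zmod_two_eq_one h0, one_smul]
  have hne : (occ S).Nonempty := Finset.card_pos.1 (by have := two_lt_card_occ hS; omega)
  obtain ⟨j₁, hj₁⟩ := hne
  obtain ⟨i₀, hi₀⟩ := mem_occ.1 hj₁
  have hi₀w : S.M i₀ = w := (hrow i₀).resolve_left fun h => hi₀ (by rw [h]; rfl)
  refine ⟨i₀, fun j => ?_, fun i => by rw [hi₀w]; exact hrow i⟩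
  split_ifs with hj
  · obtain ⟨i, hi⟩ := mem_occ.1 hj
    have : S.M i = w := (hrow i).resolve_left fun h => hi (by rw [h]; rfl)
    rw [hi₀w, ← this]
    exact zmod_two_eq_one hi
  · by_contra h
    exact hj (mem_occ.2 ⟨i₀, h⟩)

/-- A rank-one system says that the occurring variables sum to zero. -/
lemma linear_iff {S : InducedSystem} (hS : S.IsSingleEquation) {n : ℕ} (x : Fin S.k → Cube n) :
    (∀ i, ∑ j, S.M i j • x j = 0) ↔ ∑ j ∈ occ S, x j = 0 := by
  obtain ⟨i₀, h0, h⟩ := exists_row hS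
  have key : ∑ j, S.M i₀ j • x j = ∑ j ∈ occ S, x j := by
    simp_rw [h0, ite_smul, one_smul, zero_smul]
    rw [Finset.sum_ite_mem, Finset.univ_inter]
  rw [← key]
  refine ⟨fun h => h i₀, fun h' i => ?_⟩
  rcases h i with h1 | h1
  · rw [h1]; simp
  · rw [h1]; exact h'

lemma inducedAt_iff {S : InducedSystem} (hS : S.IsSingleEquation) {n : ℕ} (f : BoolFun n)
    (x : Fin S.k → Cube n) :
    S.InducedAt f x ↔ ∑ j ∈ occ S, x j = 0 ∧ ∀ j, f (x j) = S.σ j := by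
  rw [InducedSystem.InducedAt, linear_iff hS]

lemma cube_add_self {n : ℕ} (x : Cube n) : x + x = 0 := by
  funext i; exact CharTwo.add_self_eq_zero _

/-- A tuple `φ` spans an induced copy of `S` if this holds once the coordinate `j₃` has been
replaced by the value that the equation forces. -/
lemma pull_not_free {F : Set InducedSystem} {S : InducedSystem} (hSF : S ∈ F)
    (hS : S.IsSingleEquation) {n : ℕ} {f : BoolFun n} {φ : Fin S.k → Cube n} {j₃ : Fin S.k}
    (hj₃ : j₃ ∈ occ S) (h : ∀ j ≠ j₃, f (φ j) = S.σ j)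
    (h₃ : f (∑ j ∈ (occ S).erase j₃, φ j) = S.σ j₃) : pull f φ ∉ familyFree F S.k := by
  intro hf
  set x : Fin S.k → Cube S.k := fun j =>
    if j = j₃ then ∑ i ∈ (occ S).erase j₃, Pi.single i 1 else Pi.single j 1 with hx
  refine hf S hSF ⟨x, (inducedAt_iff hS _ _).2 ⟨?_, fun j => ?_⟩⟩
  · rw [← Finset.add_sum_erase _ _ hj₃]
    have : ∑ j ∈ (occ S).erase j₃, x j = ∑ i ∈ (occ S).erase j₃, Pi.single i 1 :=
      Finset.sum_congr rfl fun j hj => by simp [hx, Finset.ne_of_mem_erase hj]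
    rw [this]
    simp only [hx, if_true]
    exact cube_add_self _
  · by_cases hj : j = j₃
    · subst hj
      have e := linComb_sum φ ((occ S).erase j) (fun i => (Pi.single i 1 : Cube S.k)) fun _ => 1
      simp only [one_smul, linComb_single] at e
      simp only [pull, hx, if_true, e, h₃]
    · simp only [pull, hx, if_neg hj, linComb_single, h j hj]

/-! ### Counting solutions in prescribed sets -/

/-- If the sets `X j` have density at least `θ` and every admissible choice of all but three
variables of the equation extends in at least `θ 4^n` ways, then random tuples find an induced
copy with probability at least `θ^(k-2)`. The hypothesis on the last three variables only
concerns targets in one fibre of `ψ`, because the other variables lie in fixed fibres. -/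
lemma le_rejFrac_of_count {F : Set InducedSystem} {S : InducedSystem} (hSF : S ∈ F)
    (hS : S.IsSingleEquation) {n c : ℕ} {f : BoolFun n} (ψ : Cube n →ₗ[ZMod 2] Cube c)
    (y : Fin S.k → Cube c) (hy : ∑ j ∈ occ S, y j = 0) (X : Fin S.k → Finset (Cube n))
    (hX : ∀ j, ∀ x ∈ X j, f x = S.σ j) (hXψ : ∀ j ∈ occ S, ∀ x ∈ X j, ψ x = y j)
    {j₁ j₂ j₃ : Fin S.k} (h₁ : j₁ ∈ occ S) (h₂ : j₂ ∈ occ S) (h₃ : j₃ ∈ occ S)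
    (h₁₂ : j₁ ≠ j₂) (h₁₃ : j₁ ≠ j₃) (h₂₃ : j₂ ≠ j₃) {θ : ℝ} (hθ : 0 ≤ θ)
    (hXcard : ∀ j, θ * 2 ^ n ≤ #(X j))
    (hcount : ∀ s : Cube n, ψ s = y j₁ + y j₂ + y j₃ →
      θ * (2 ^ n) ^ 2 ≤ (#{p ∈ X j₁ ×ˢ X j₂ | s + p.1 + p.2 ∈ X j₃} : ℝ)) :
    θ ^ (S.k - 2) ≤ rejFrac F S.k f := by
  set T : Finset (Fin S.k) := {j₁, j₂, j₃} with hT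
  have hTcard : #T = 3 := by
    rw [hT, Finset.card_eq_three]; exact ⟨j₁, j₂, j₃, h₁₂, h₁₃, h₂₃, rfl⟩
  have hTocc : T ⊆ occ S := by
    intro j hj
    simp only [hT, Finset.mem_insert, Finset.mem_singleton] at hj
    rcases hj with rfl | rfl | rfl <;> assumption
  have hk : 3 ≤ S.k := by
    have := Finset.card_le_univ T
    rwa [hTcard, Fintype.card_fin] at this
  set Z : Fin S.k → Finset (Cube n) := fun j => if j ∈ T then {0} else X j with hZ
  set s : (Fin S.k → Cube n) → Cube n := fun z => ∑ j ∈ occ S \ T, z j with hs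
  set Q : (Fin S.k → Cube n) → Finset (Cube n × Cube n) := fun z =>
    {p ∈ X j₁ ×ˢ X j₂ | s z + p.1 + p.2 ∈ X j₃} with hQ
  have hZT : ∀ z ∈ Fintype.piFinset Z, ∀ j ∉ T, z j ∈ X j := fun z hz j hj => by
    have := Fintype.mem_piFinset.1 hz j
    simpa [hZ, hj] using this
  have hZ0 : ∀ z ∈ Fintype.piFinset Z, ∀ j ∈ T, z j = 0 := fun z hz j hj => by
    have := Fintype.mem_piFinset.1 hz j
    simpa [hZ, hj] using this
  have hN : (0 : ℝ) < 2 ^ n := by positivity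
  -- the free choices: the variables outside `T`, then two of the last three, and a dummy value
  have hQcard : ∀ z ∈ Fintype.piFinset Z, θ * (2 ^ n) ^ 2 ≤ (#(Q z) : ℝ) := fun z hz => by
    refine hcount _ ?_
    have e1 : ψ (s z) = ∑ j ∈ occ S \ T, y j := by
      rw [hs, map_sum]
      refine Finset.sum_congr rfl fun j hj => ?_
      rw [Finset.mem_sdiff] at hj
      exact hXψ j hj.1 _ (hZT z hz j hj.2)
    have e2 := Finset.sum_sdiff (f := y) hTocc
    rw [hy] at e2
    have e3 : ∑ j ∈ T, y j = y j₁ + y j₂ + y j₃ := by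
      rw [hT, Finset.sum_insert (by simp [h₁₂, h₁₃]), Finset.sum_insert (by simp [h₂₃]),
        Finset.sum_singleton, add_assoc]
    rw [e1, ← e3]
    calc _ = (∑ j ∈ occ S \ T, y j + ∑ j ∈ T, y j) + ∑ j ∈ T, y j := by
          rw [add_assoc, cube_add_self, add_zero]
      _ = _ := by rw [e2, zero_add]
  have hZcard : (θ * 2 ^ n) ^ (S.k - 3) ≤ (#(Fintype.piFinset Z) : ℝ) := by
    rw [Fintype.card_piFinset]
    push_cast
    rw [← Finset.prod_sdiff (Finset.subset_univ T)]
    have e1 : ∏ j ∈ T, (#(Z j) : ℝ) = 1 :=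
      Finset.prod_eq_one fun j hj => by simp [hZ, hj]
    have e2 : S.k - 3 = #(univ \ T) := by
      rw [Finset.card_sdiff_of_subset (Finset.subset_univ T), hTcard, Finset.card_univ,
        Fintype.card_fin]
    rw [e1, mul_one, e2, ← Finset.prod_const]
    refine Finset.prod_le_prod (fun _ _ => by positivity) fun j hj => ?_
    simpa [hZ, (Finset.mem_sdiff.1 hj).2] using hXcard j
  have hsig : (θ * 2 ^ n) ^ (S.k - 3) * (θ * (2 ^ n) ^ 2) ≤
      (#((Fintype.piFinset Z).sigma Q) : ℝ) := by
    rw [Finset.card_sigma]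
    push_cast
    calc _ ≤ (#(Fintype.piFinset Z) : ℝ) * (θ * (2 ^ n) ^ 2) := by gcongr
      _ = ∑ z ∈ Fintype.piFinset Z, θ * (2 ^ n) ^ 2 := by rw [Finset.sum_const, nsmul_eq_mul]
      _ ≤ _ := Finset.sum_le_sum hQcard
  have hinj : #(((Fintype.piFinset Z).sigma Q) ×ˢ (univ : Finset (Cube n))) ≤
      #{φ : Fin S.k → Cube n | pull f φ ∉ familyFree F S.k} := by
    refine Finset.card_le_card_of_injOn (fun p => Function.update (Function.update
      (Function.update p.1.1 j₁ p.1.2.1) j₂ p.1.2.2) j₃ p.2) ?_ ?_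
    · rintro ⟨⟨z, u, v⟩, w⟩ hp
      simp only [coe_product, coe_sigma, Set.mem_prod, Set.mem_sigma_iff, mem_coe, coe_univ,
        Set.mem_univ, and_true] at hp
      obtain ⟨hz, hp⟩ := hp
      simp only [hQ, mem_filter, mem_product] at hp
      obtain ⟨⟨hu, hv⟩, huv⟩ := hp
      simp only [coe_filter, mem_univ, true_and, Set.mem_ofPred_eq]
      refine pull_not_free hSF hS h₃ (fun j hj => ?_) ?_
      · rw [Function.update_of_ne hj]
        by_cases hj2 : j = j₂
        · subst hj2; rw [Function.update_self]; exact hX _ _ hv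
        · rw [Function.update_of_ne hj2]
          by_cases hj1 : j = j₁
          · subst hj1; rw [Function.update_self]; exact hX _ _ hu
          · rw [Function.update_of_ne hj1]
            exact hX _ _ (hZT z hz j (by simp [hT, hj, hj1, hj2]))
      · have e : (occ S).erase j₃ = insert j₁ (insert j₂ (occ S \ T)) := by
          ext j
          simp only [mem_erase, mem_insert, Finset.mem_sdiff, hT, mem_singleton, not_or]
          constructor
          · tauto
          · rintro (rfl | rfl | h)
            · exact ⟨h₁₃, h₁⟩
            · exact ⟨h₂₃, h₂⟩
            · exact ⟨h.2.2.2, h.1⟩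
        rw [e, Finset.sum_insert (by simp [hT, h₁₂]), Finset.sum_insert (by simp [hT])]
        have e2 : ∑ j ∈ occ S \ T, Function.update (Function.update
            (Function.update z j₁ u) j₂ v) j₃ w j = s z := by
          refine Finset.sum_congr rfl fun j hj => ?_
          simp only [hT, Finset.mem_sdiff, mem_insert, mem_singleton, not_or] at hj
          rw [Function.update_of_ne hj.2.2.2, Function.update_of_ne hj.2.2.1,
            Function.update_of_ne hj.2.1]
        rw [e2, Function.update_of_ne h₁₃, Function.update_of_ne h₁₂, Function.update_self,
          Function.update_of_ne h₂₃, Function.update_self]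
        have e3 : u + (v + s z) = s z + u + v := by abel
        rw [e3]
        exact hX _ _ huv
    · rintro ⟨⟨z, u, v⟩, w⟩ hp ⟨⟨z', u', v'⟩, w'⟩ hp' heq
      simp only [coe_product, coe_sigma, Set.mem_prod, Set.mem_sigma_iff, mem_coe, coe_univ,
        Set.mem_univ, and_true] at hp hp'
      have h3 := congrFun heq j₃
      have h2 := congrFun heq j₂
      have h1 := congrFun heq j₁
      simp only [Function.update_self, Function.update_of_ne h₂₃, Function.update_of_ne h₁₃,
        Function.update_of_ne h₁₂] at h1 h2 h3
      have hz : z = z' := by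
        funext j
        by_cases hj : j ∈ T
        · rw [hZ0 z hp.1 j hj, hZ0 z' hp'.1 j hj]
        · have := congrFun heq j
          simp only [hT, mem_insert, mem_singleton, not_or] at hj
          simpa [Function.update_of_ne, hj.1, hj.2.1, hj.2.2] using this
      subst hz h1 h2 h3
      rfl
  rw [Finset.card_product, Finset.card_univ, card_cube] at hinj
  have hinj' : (#((Fintype.piFinset Z).sigma Q) : ℝ) * 2 ^ n ≤
      #{φ : Fin S.k → Cube n | pull f φ ∉ familyFree F S.k} := by exact_mod_cast hinj
  unfold rejFrac
  rw [le_div_iff₀ (by positivity)]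
  refine le_trans (le_of_eq ?_) ((mul_le_mul_of_nonneg_right hsig hN.le).trans hinj')
  obtain ⟨k', hk'⟩ := Nat.exists_eq_add_of_le hk
  rw [hk', show 3 + k' - 2 = k' + 1 by omega, show 3 + k' - 3 = k' by omega, mul_pow]
  ring

/-! ### Functions close to a function of boundedly many linear forms -/

lemma card_fiber_eq {n c : ℕ} (ψ : Cube n →ₗ[ZMod 2] Cube c) (x₀ : Cube n) :
    #{x | ψ x = ψ x₀} = #{x | ψ x = 0} := by
  refine Finset.card_bij' (fun x _ => x + x₀) (fun x _ => x + x₀) ?_ ?_ ?_ ?_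
  · intro x hx
    simp only [mem_filter, mem_univ, true_and] at hx ⊢
    rw [map_add, hx, cube_add_self]
  · intro x hx
    simp only [mem_filter, mem_univ, true_and] at hx ⊢
    rw [map_add, hx, zero_add]
  · intro x _; rw [add_assoc, cube_add_self, add_zero]
  · intro x _; rw [add_assoc, cube_add_self, add_zero]

lemma card_fiber_le {n c : ℕ} (ψ : Cube n →ₗ[ZMod 2] Cube c) (y : Cube c) :
    #{x | ψ x = y} ≤ #{x | ψ x = 0} := by
  by_cases h : ∃ x₀, ψ x₀ = y
  · obtain ⟨x₀, rfl⟩ := h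
    exact (card_fiber_eq ψ x₀).le
  · rw [Finset.filter_false_of_mem fun x _ hx => h ⟨x, hx⟩]
    simp

lemma two_pow_le_card_ker {n c : ℕ} (ψ : Cube n →ₗ[ZMod 2] Cube c) :
    (2 : ℝ) ^ n ≤ 2 ^ c * #{x | ψ x = 0} := by
  have h := Finset.card_le_mul_card_image_of_maps_to (f := ψ) (s := univ) (t := univ)
    (fun _ _ => mem_univ _) (#{x | ψ x = 0}) (fun y _ => card_fiber_le ψ y)
  rw [Finset.card_univ, Finset.card_univ, card_cube, card_cube] at h
  rw [mul_comm]
  exact_mod_cast h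

/-- Counting `u + v + w = s` by inclusion-exclusion, for sets that nearly fill their fibres. -/
lemma le_card_triples {n c : ℕ} (ψ : Cube n →ₗ[ZMod 2] Cube c) {y₁ y₂ y₃ : Cube c}
    {X₁ X₂ X₃ : Finset (Cube n)} (h₁ : ∀ x ∈ X₁, ψ x = y₁) (h₂ : ∀ x ∈ X₂, ψ x = y₂)
    (h₃ : ∀ x ∈ X₃, ψ x = y₃) {s : Cube n} (hs : ψ s = y₁ + y₂ + y₃) :
    (#X₁ : ℝ) * (#X₂ + #X₃ - #{x | ψ x = 0}) ≤
      (#{p ∈ X₁ ×ˢ X₂ | s + p.1 + p.2 ∈ X₃} : ℝ) := by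
  have hinner : ∀ u ∈ X₁, (#X₂ + #X₃ - #{x | ψ x = 0} : ℝ) ≤ #{v ∈ X₂ | s + u + v ∈ X₃} := by
    intro u hu
    set Y := X₃.image (fun w => s + u + w) with hY
    have hYcard : #Y = #X₃ := Finset.card_image_of_injective _ (add_right_injective _)
    have hinter : X₂ ∩ Y ⊆ {v ∈ X₂ | s + u + v ∈ X₃} := by
      intro v hv
      rw [Finset.mem_inter, hY, Finset.mem_image] at hv
      obtain ⟨hv, w, hw, rfl⟩ := hv
      rw [Finset.mem_filter]
      refine ⟨hv, ?_⟩
      rw [← add_assoc, cube_add_self, zero_add]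
      exact hw
    have hunion : X₂ ∪ Y ⊆ ({x | ψ x = y₂} : Finset (Cube n)) := by
      intro v hv
      rw [Finset.mem_union, hY, Finset.mem_image] at hv
      simp only [mem_filter, mem_univ, true_and]
      rcases hv with hv | ⟨w, hw, rfl⟩
      · exact h₂ v hv
      · rw [map_add, map_add, hs, h₁ u hu, h₃ w hw]
        calc _ = y₂ + (y₁ + y₁) + (y₃ + y₃) := by abel
          _ = _ := by rw [cube_add_self, cube_add_self, add_zero, add_zero]
    have e := Finset.card_union_add_card_inter X₂ Y
    have l1 := Finset.card_le_card hinter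
    have l2 := (Finset.card_le_card hunion).trans (card_fiber_le ψ y₂)
    rw [hYcard] at e
    have e' : (#(X₂ ∪ Y) : ℝ) + #(X₂ ∩ Y) = #X₂ + #X₃ := by exact_mod_cast e
    have l1' : (#(X₂ ∩ Y) : ℝ) ≤ #{v ∈ X₂ | s + u + v ∈ X₃} := by exact_mod_cast l1
    have l2' : (#(X₂ ∪ Y) : ℝ) ≤ #{x | ψ x = 0} := by exact_mod_cast l2
    linarith
  have e : #{p ∈ X₁ ×ˢ X₂ | s + p.1 + p.2 ∈ X₃} = ∑ u ∈ X₁, #{v ∈ X₂ | s + u + v ∈ X₃} := by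
    rw [Finset.card_filter, Finset.sum_product]
    simp_rw [Finset.card_filter]
  rw [e]
  push_cast
  rw [← nsmul_eq_mul, ← Finset.sum_const]
  exact Finset.sum_le_sum hinner

lemma exists_three_occ {S : InducedSystem} (hS : S.IsSingleEquation) :
    ∃ j₁ j₂ j₃, j₁ ∈ occ S ∧ j₂ ∈ occ S ∧ j₃ ∈ occ S ∧ j₁ ≠ j₂ ∧ j₁ ≠ j₃ ∧ j₂ ≠ j₃ := by
  obtain ⟨a, b, c, ha, hb, hc, h⟩ := Finset.two_lt_card_iff.1 (two_lt_card_occ hS)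
  exact ⟨a, b, c, ha, hb, hc, h⟩

lemma isFar_card {ε : ℝ} {n : ℕ} {f g : BoolFun n} (h : IsFar ε f g) :
    ε * 2 ^ n ≤ (#{x | f x ≠ g x} : ℝ) := by
  unfold IsFar at h
  rw [Set.ncard_eq_toFinset_card'] at h
  convert h using 3
  ext; simp

/-- If `g ∘ ψ` violates `F` then any `f` sufficiently close to it contains a positive fraction of
the solutions in the same fibres of `ψ`. If `g ∘ ψ` is `F`-free then an `ε`-far `f` is not close to
it. For given `c` there are finitely many pairs `(g, range ψ)`, so one bound serves them all. -/
lemma eventually_rejects_of_near_junta {F : Set InducedSystem} (hF : ∀ S ∈ F, S.IsSingleEquation)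
    {ε : ℝ} (hε : 0 < ε) (c : ℕ) :
    ∀ᶠ q : ℕ in atTop, ∀ (n : ℕ) (f : BoolFun n) (ψ : Cube n →ₗ[ZMod 2] Cube c) (g : BoolFun c),
      IsFarFrom ε (familyFree F) f → (q : ℝ) * #{x | f x ≠ g (ψ x)} ≤ 2 ^ n → Rejects F q f := by
  suffices h : ∀ (g : BoolFun c) (W : Set (Cube c)), ∀ᶠ q : ℕ in atTop, ∀ (n : ℕ) (f : BoolFun n)
      (ψ : Cube n →ₗ[ZMod 2] Cube c), Set.range ψ = W → IsFarFrom ε (familyFree F) f →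
      (q : ℝ) * #{x | f x ≠ g (ψ x)} ≤ 2 ^ n → Rejects F q f by
    have h' := Filter.eventually_all.2 fun g => Filter.eventually_all.2 (h g)
    filter_upwards [h'] with q hq n f ψ g
    exact hq g _ n f ψ rfl
  intro g W
  by_cases hex : ∃ S ∈ F, ∃ y : Fin S.k → Cube c, (∀ j, y j ∈ W) ∧ S.InducedAt g y
  · obtain ⟨S, hSF, y, hyW, hy⟩ := hex
    have hS := hF S hSF
    obtain ⟨hy0, hyσ⟩ := (inducedAt_iff hS g y).1 hy
    obtain ⟨j₁, j₂, j₃, h₁, h₂, h₃, h₁₂, h₁₃, h₂₃⟩ := exists_three_occ hS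
    set κ : ℝ := 1 / 2 ^ c with hκ
    have hκ0 : 0 < κ := by positivity
    have hκ1 : κ ≤ 1 := by
      rw [hκ, div_le_one (by positivity)]; exact one_le_pow₀ (by norm_num)
    have hθ : 0 < κ ^ 2 / 2 := by positivity
    filter_upwards [eventually_rejects F S.k (pow_pos hθ (S.k - 2)),
      eventually_ge_atTop (8 * 2 ^ c)] with q hq hq8 n f ψ hW hfar hclose
    refine hq n f ?_
    set m : ℝ := (#{x | ψ x = 0} : ℝ) with hm
    set D : ℝ := (#{x | f x ≠ g (ψ x)} : ℝ) with hD
    have hN : (0 : ℝ) < 2 ^ n := by positivity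
    have hmN : κ * 2 ^ n ≤ m := by
      rw [hκ, div_mul_eq_mul_div, one_mul, div_le_iff₀ (by positivity), mul_comm]
      exact two_pow_le_card_ker ψ
    have hm0 : 0 < m := lt_of_lt_of_le (by positivity) hmN
    have hD0 : 0 ≤ D := by positivity
    have hDm : 8 * D ≤ m := by
      have hq8' : (8 * 2 ^ c : ℝ) ≤ q := by exact_mod_cast hq8
      have : 8 * 2 ^ c * D ≤ 2 ^ c * m :=
        calc 8 * 2 ^ c * D ≤ q * D := by gcongr
          _ ≤ 2 ^ n := hclose
          _ ≤ 2 ^ c * m := two_pow_le_card_ker ψ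
      have h2 : (0 : ℝ) < 2 ^ c := by positivity
      nlinarith
    set X : Fin S.k → Finset (Cube n) := fun j => {x | ψ x = y j ∧ f x = S.σ j} with hX
    have hXcard : ∀ j, m - D ≤ (#(X j) : ℝ) := by
      intro j
      obtain ⟨x₀, hx₀⟩ : y j ∈ Set.range ψ := hW ▸ hyW j
      have hsub : ({x | ψ x = y j} : Finset (Cube n)) ⊆
          X j ∪ ({x | f x ≠ g (ψ x)} : Finset (Cube n)) := by
        intro x hx
        simp only [hX, mem_filter, mem_univ, true_and, Finset.mem_union] at hx ⊢
        by_cases hfx : f x = S.σ j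
        · exact Or.inl ⟨hx, hfx⟩
        · right; rw [hx, hyσ j]; exact hfx
      have := (Finset.card_le_card hsub).trans (Finset.card_union_le _ _)
      rw [← hx₀, card_fiber_eq] at this
      have : m ≤ #(X j) + D := by rw [hm, hD]; exact_mod_cast this
      linarith
    have hXψ : ∀ j, ∀ x ∈ X j, ψ x = y j := fun j x hx => by
      simp only [hX, mem_filter] at hx
      exact hx.2.1
    refine le_rejFrac_of_count hSF hS ψ y hy0 X (fun j x hx => ?_) (fun j _ => hXψ j) h₁ h₂ h₃
      h₁₂ h₁₃ h₂₃ hθ.le (fun j => ?_) fun s hs => ?_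
    · simp only [hX, mem_filter] at hx
      exact hx.2.2
    · refine le_trans ?_ (hXcard j)
      have : κ ^ 2 / 2 * 2 ^ n ≤ 1 / 2 * (κ * 2 ^ n) := by
        have : κ ^ 2 ≤ κ := by nlinarith
        nlinarith
      linarith
    · refine le_trans ?_ (le_card_triples ψ (hXψ j₁) (hXψ j₂) (hXψ j₃) hs)
      have b1 := hXcard j₁
      have b2 := hXcard j₂
      have b3 := hXcard j₃
      calc κ ^ 2 / 2 * (2 ^ n) ^ 2 = (κ * 2 ^ n) ^ 2 / 2 := by ring
        _ ≤ m ^ 2 / 2 := by gcongr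
        _ ≤ (7 / 8 * m) * (6 / 8 * m) := by nlinarith
        _ ≤ _ := by
          refine mul_le_mul ?_ ?_ (by positivity) (by positivity)
          · linarith
          · rw [← hm]; linarith
  · obtain ⟨q₀, hq₀⟩ := exists_nat_gt (1 / ε)
    filter_upwards [eventually_ge_atTop q₀] with q hq n f ψ hW hfar hclose
    exfalso
    have hfree : (fun x => g (ψ x)) ∈ familyFree F n := by
      rintro S hSF ⟨x, hx⟩
      refine hex ⟨S, hSF, fun j => ψ (x j), fun j => hW ▸ ⟨x j, rfl⟩, fun i => ?_, hx.2⟩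
      have := congrArg ψ (hx.1 i)
      simpa [map_sum] using this
    have h := isFar_card (hfar _ hfree)
    have hN : (0 : ℝ) < 2 ^ n := by positivity
    have hq' : 1 / ε < q := hq₀.trans_le (by exact_mod_cast hq)
    rw [div_lt_iff₀ hε] at hq'
    have hq0 : (0 : ℝ) ≤ q := by positivity
    have : (q : ℝ) * (ε * 2 ^ n) ≤ 2 ^ n := (mul_le_mul_of_nonneg_left h hq0).trans hclose
    nlinarith

/-! ### Families whose patterns use both values -/

/-- The occurring variables that are to take the value `v`. -/
noncomputable def occVal (S : InducedSystem) (v : Bool) : Finset (Fin S.k) :=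
  {j ∈ occ S | S.σ j = v}

/-- `t` is a sum, over the occurring variables with pattern value `v`, of points of `h⁻¹(v)`. The
tuple `x` is indexed by all variables, so that it also provides values for the variables that carry
the value `v` without occurring in the equation. -/
def Attains {d : ℕ} (h : BoolFun d) (S : InducedSystem) (v : Bool) (t : Cube d) : Prop :=
  ∃ x : Fin S.k → Cube d, (∀ j, h (x j) = v) ∧ ∑ j ∈ occVal S v, x j = t

lemma not_mem_of_attains {F : Set InducedSystem} {S : InducedSystem} (hSF : S ∈ F)
    (hS : S.IsSingleEquation) {d : ℕ} {h : BoolFun d} {t : Cube d} {v : Bool}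
    (h₁ : Attains h S v t) (h₂ : Attains h S (!v) t) : h ∉ familyFree F d := by
  obtain ⟨x, hx, hxt⟩ := h₁
  obtain ⟨y, hy, hyt⟩ := h₂
  intro hfree
  refine hfree S hSF ⟨fun j => if S.σ j = v then x j else y j,
    (inducedAt_iff hS _ _).2 ⟨?_, fun j => ?_⟩⟩
  · rw [← Finset.sum_filter_add_sum_filter_not _ (fun j => S.σ j = v)]
    have e1 : ∑ j ∈ occ S with S.σ j = v, (if S.σ j = v then x j else y j) = t := by
      rw [← hxt]
      exact Finset.sum_congr rfl fun j hj => if_pos (Finset.mem_filter.1 hj).2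
    have e2 : ∑ j ∈ occ S with ¬S.σ j = v, (if S.σ j = v then x j else y j) = t := by
      rw [← hyt]
      refine Finset.sum_congr ?_ fun j hj => ?_
      · ext j; simp [occVal, Bool.eq_not]
      · have := (Finset.mem_filter.1 hj).2
        rw [Bool.eq_not] at this
        exact if_neg this
    rw [e1, e2, cube_add_self]
  · by_cases hj : S.σ j = v
    · simp only [hj, if_true, hx]
    · simp only [hj, if_false, hy]
      exact (Bool.eq_not.2 hj).symm

lemma nsmul_of_even {d m : ℕ} (hm : Even m) (p : Cube d) : m • p = 0 := by
  obtain ⟨r, rfl⟩ := hm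
  rw [add_nsmul, cube_add_self]

lemma nsmul_of_odd {d m : ℕ} (hm : Odd m) (p : Cube d) : m • p = p := by
  obtain ⟨r, rfl⟩ := hm
  rw [succ_nsmul, mul_nsmul, two_nsmul, cube_add_self, smul_zero, zero_add]

lemma attains_const {d : ℕ} {h : BoolFun d} {S : InducedSystem} {v : Bool} {p : Cube d}
    (hp : h p = v) : Attains h S v (#(occVal S v) • p) :=
  ⟨fun _ => p, fun _ => hp, by simp⟩

lemma attains_pair {d : ℕ} {h : BoolFun d} {S : InducedSystem} {v : Bool}
    (hcard : 1 < #(occVal S v)) {a b p : Cube d} (ha : h a = v) (hb : h b = v) (hp : h p = v) :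
    Attains h S v (a + b + (#(occVal S v) - 2) • p) := by
  obtain ⟨j₁, h₁, j₂, h₂, h₁₂⟩ := Finset.one_lt_card.1 hcard
  refine ⟨Function.update (Function.update (fun _ => p) j₁ a) j₂ b, fun j => ?_, ?_⟩
  · by_cases hj₂ : j = j₂
    · subst hj₂; simpa using hb
    · by_cases hj₁ : j = j₁
      · subst hj₁; simpa [hj₂] using ha
      · simpa [hj₂, hj₁] using hp
  · rw [Finset.sum_update_of_mem h₂, Finset.sum_update_of_mem
      (by simp [h₁, h₁₂] : j₁ ∈ occVal S v \ {j₂}), Finset.sum_const]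
    have e : #((occVal S v \ {j₂}) \ {j₁}) = #(occVal S v) - 2 := by
      rw [Finset.sdiff_singleton_eq_erase, Finset.sdiff_singleton_eq_erase,
        Finset.card_erase_of_mem (Finset.mem_erase.2 ⟨h₁₂, h₁⟩), Finset.card_erase_of_mem h₂]
      omega
    rw [e]
    abel

lemma attains_three {d : ℕ} {h : BoolFun d} {S : InducedSystem} {v : Bool}
    (hodd : Odd #(occVal S v)) (hcard : 1 < #(occVal S v)) {a b p : Cube d} (ha : h a = v)
    (hb : h b = v) (hp : h p = v) : Attains h S v (a + b + p) := by
  have := attains_pair (S := S) hcard ha hb hp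
  rwa [nsmul_of_odd (by
    obtain ⟨r, hr⟩ := hodd
    exact ⟨r - 1, by omega⟩)] at this

lemma attains_two {d : ℕ} {h : BoolFun d} {S : InducedSystem} {v : Bool}
    (heven : Even #(occVal S v)) (hcard : 0 < #(occVal S v)) {a b : Cube d} (ha : h a = v)
    (hb : h b = v) : Attains h S v (a + b) := by
  have hcard' : 1 < #(occVal S v) := by
    obtain ⟨r, hr⟩ := heven
    omega
  have := attains_pair (S := S) hcard' ha hb hb
  rwa [nsmul_of_even (by
    obtain ⟨r, hr⟩ := heven
    exact ⟨r - 1, by omega⟩), add_zero] at this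

lemma attains_one {d : ℕ} {h : BoolFun d} {S : InducedSystem} {v : Bool}
    (hodd : Odd #(occVal S v)) {p : Cube d} (hp : h p = v) : Attains h S v p := by
  have := attains_const (S := S) hp
  rwa [nsmul_of_odd hodd] at this

lemma attains_zero {d : ℕ} {h : BoolFun d} {S : InducedSystem} {v : Bool}
    (heven : Even #(occVal S v)) {p : Cube d} (hp : h p = v) : Attains h S v 0 := by
  have := attains_const (S := S) hp
  rwa [nsmul_of_even heven] at this

/-- The class `h⁻¹(v)` is closed under sums of three elements: it is empty or an affine
subspace. -/
def ClosedUnderTriples {d : ℕ} (h : BoolFun d) (v : Bool) : Prop :=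
  ∀ x y z, h x = v → h y = v → h z = v → h (x + y + z) = v

lemma card_occVal_add (S : InducedSystem) (v : Bool) :
    #(occVal S v) + #(occVal S (!v)) = #(occ S) := by
  rw [← Finset.card_filter_add_card_filter_not (s := occ S) (fun j => S.σ j = v)]
  congr 2
  ext j
  simp [occVal, Bool.eq_not]

/-- The case in which the value `v` occurs an odd number, at least three, of times. -/
lemma closed_of_odd_of_three_le {F : Set InducedSystem} {S : InducedSystem} (hSF : S ∈ F)
    (hS : S.IsSingleEquation) {v : Bool} (hodd : Odd #(occVal S v)) (h3 : 1 < #(occVal S v))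
    (hpos : 0 < #(occVal S (!v))) {d : ℕ} {h : BoolFun d} (hfree : h ∈ familyFree F d) :
    ClosedUnderTriples h v := by
  intro x y z hx hy hz
  by_contra hw
  have hw' : h (x + y + z) = !v := Bool.eq_not.2 hw
  rcases Nat.even_or_odd #(occVal S (!v)) with he | ho
  · -- `0` lies in `h⁻¹(v)`, for otherwise `x + y + z` is a sum of two points of `h⁻¹(!v)`
    have h0 : h 0 = v := by
      by_contra h0
      have := attains_two he hpos hw' (Bool.eq_not.2 h0)
      rw [add_zero] at this
      exact not_mem_of_attains hSF hS (attains_three hodd h3 hx hy hz) this hfree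
    exact not_mem_of_attains hSF hS (attains_one hodd h0) (attains_zero he hw') hfree
  · exact not_mem_of_attains hSF hS (attains_three hodd h3 hx hy hz) (attains_one ho hw') hfree

/-- The case in which `v` occurs once and `!v` an even number of times: `h⁻¹(!v)` is then a linear
subspace. -/
lemma closed_of_one_of_even {F : Set InducedSystem} {S : InducedSystem} (hSF : S ∈ F)
    (hS : S.IsSingleEquation) {v : Bool} (hodd : Odd #(occVal S v))
    (heven : Even #(occVal S (!v))) (hpos : 0 < #(occVal S (!v))) {d : ℕ} {h : BoolFun d}
    (hfree : h ∈ familyFree F d) : ClosedUnderTriples h (!v) := by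
  have h2 : ∀ x y, h x = (!v) → h y = (!v) → h (x + y) = !v := fun x y hx hy => by
    by_contra hxy
    rw [← ne_eq, Bool.ne_not] at hxy
    exact not_mem_of_attains hSF hS (attains_one hodd hxy) (attains_two heven hpos hx hy) hfree
  exact fun x y z hx hy hz => h2 _ _ (h2 _ _ hx hy) hz

lemma exists_closed_of_mixed {F : Set InducedSystem} {S : InducedSystem} (hSF : S ∈ F)
    (hS : S.IsSingleEquation) (hpos : ∀ v, 0 < #(occVal S v)) :
    ∃ v, ∀ (d : ℕ) (h : BoolFun d), h ∈ familyFree F d → (∀ w, ∃ x, h x = w) →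
      ClosedUnderTriples h v := by
  by_cases hev : ∀ v, Even #(occVal S v)
  · refine ⟨true, fun d h hfree hne => ?_⟩
    obtain ⟨p, hp⟩ := hne true
    obtain ⟨q, hq⟩ := hne false
    exact absurd hfree (not_mem_of_attains hSF hS (v := true) (attains_zero (hev _) hp)
      (attains_zero (hev _) hq))
  push Not at hev
  obtain ⟨v, hodd⟩ := hev
  rw [Nat.not_even_iff_odd] at hodd
  by_cases h3 : 1 < #(occVal S v)
  · exact ⟨v, fun d h hfree _ => closed_of_odd_of_three_le hSF hS hodd h3 (hpos _) hfree⟩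
  refine ⟨!v, fun d h hfree _ => ?_⟩
  rcases Nat.even_or_odd #(occVal S (!v)) with he | ho
  · exact closed_of_one_of_even hSF hS hodd he (hpos _) hfree
  · refine closed_of_odd_of_three_le hSF hS ho ?_ (by simpa using hpos v) hfree
    have := card_occVal_add S v
    have := two_lt_card_occ hS
    omega

/-- If no value is shared by all occurring variables of all patterns in `F`, then one of the two
classes of any nonconstant `F`-free function is an affine subspace. -/
lemma exists_closedUnderTriples {F : Set InducedSystem} (hF : ∀ S ∈ F, S.IsSingleEquation)
    (hmix : ∀ v, ∃ S ∈ F, ∃ j ∈ occ S, S.σ j ≠ v) :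
    ∃ v, ∀ (d : ℕ) (h : BoolFun d), h ∈ familyFree F d → (∀ w, ∃ x, h x = w) →
      ClosedUnderTriples h v := by
  by_cases hex : ∃ S ∈ F, ∀ v, 0 < #(occVal S v)
  · obtain ⟨S, hSF, hpos⟩ := hex
    exact exists_closed_of_mixed hSF (hF S hSF) hpos
  · -- every pattern is constant and both constants occur: the zero tuple is a solution
    push Not at hex
    refine ⟨true, fun d h hfree hne => absurd hfree ?_⟩
    obtain ⟨S, hSF, j, hj, hσ⟩ := hmix (!h 0)
    rw [Bool.ne_not] at hσ
    obtain ⟨w, hw⟩ := hex S hSF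
    have hw0 : #(occVal S w) = 0 := by omega
    have hjmem : 0 < #(occVal S (h 0)) :=
      Finset.card_pos.2 ⟨j, Finset.mem_filter.2 ⟨hj, hσ⟩⟩
    have hwne : w = !h 0 := by
      rw [Bool.eq_not]; rintro rfl; omega
    rw [hwne] at hw0
    obtain ⟨p, hp⟩ := hne (!h 0)
    refine not_mem_of_attains hSF (hF S hSF) (v := h 0) (t := 0) ⟨fun _ => 0, fun _ => rfl, by simp⟩
      (attains_zero (by rw [hw0]; exact Even.zero) hp)

/-! ### Sets that are nearly closed under sums of three elements -/

lemma exists_submodule_of_small_doubling {n : ℕ} {K : Finset (Cube n)} (hne : K.Nonempty)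
    (h : 2 * #(K + K) < 3 * #K) :
    ∃ V : Submodule (ZMod 2) (Cube n), ∀ x, x ∈ V ↔ x ∈ K + K := by
  -- every element of `K + K` has more than `#K / 2` representations
  have hrep : ∀ x ∈ K + K, #K < 2 * #{u ∈ K | u + x ∈ K} := by
    intro x hx
    obtain ⟨a, ha, b, hb, rfl⟩ := Finset.mem_add.1 hx
    have hunion : K.image (a + ·) ∪ K.image (b + ·) ⊆ K + K := by
      intro z hz
      rcases Finset.mem_union.1 hz with hz | hz <;> obtain ⟨u, hu, rfl⟩ := Finset.mem_image.1 hz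
      · exact Finset.add_mem_add ha hu
      · exact Finset.add_mem_add hb hu
    have hinter : #(K.image (a + ·) ∩ K.image (b + ·)) ≤ #{u ∈ K | u + (a + b) ∈ K} := by
      refine Finset.card_le_card_of_injOn (a + ·) ?_ (add_right_injective a).injOn
      intro z hz
      rw [mem_coe, Finset.mem_inter, Finset.mem_image, Finset.mem_image] at hz
      obtain ⟨⟨u, hu, rfl⟩, w, hw, hwz⟩ := hz
      rw [mem_coe, Finset.mem_filter]
      have e1 : a + (a + u) = u := by rw [← add_assoc, cube_add_self, zero_add]
      have e2 : u + (a + b) = w :=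
        calc u + (a + b) = (a + u) + b := by abel
          _ = (b + b) + w := by rw [← hwz]; abel
          _ = w := by rw [cube_add_self, zero_add]
      simp only [e1, e2]
      exact ⟨hu, hw⟩
    have e := Finset.card_union_add_card_inter (K.image (a + ·)) (K.image (b + ·))
    rw [Finset.card_image_of_injective _ (add_right_injective a),
      Finset.card_image_of_injective _ (add_right_injective b)] at e
    have := Finset.card_le_card hunion
    omega
  have hadd : ∀ x y, x ∈ K + K → y ∈ K + K → x + y ∈ K + K := by
    intro x y hx hy
    have e := Finset.card_union_add_card_inter {u ∈ K | u + x ∈ K} {u ∈ K | u + y ∈ K}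
    have hsub : {u ∈ K | u + x ∈ K} ∪ {u ∈ K | u + y ∈ K} ⊆ K :=
      Finset.union_subset (Finset.filter_subset _ _) (Finset.filter_subset _ _)
    have h1 := Finset.card_le_card hsub
    have h2 := hrep x hx
    have h3 := hrep y hy
    obtain ⟨u, hu⟩ : ({u ∈ K | u + x ∈ K} ∩ {u ∈ K | u + y ∈ K}).Nonempty :=
      Finset.card_pos.1 (by omega)
    rw [Finset.mem_inter, Finset.mem_filter, Finset.mem_filter] at hu
    refine Finset.mem_add.2 ⟨u + x, hu.1.2, u + y, hu.2.2, ?_⟩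
    calc u + x + (u + y) = (u + u) + (x + y) := by abel
      _ = _ := by rw [cube_add_self, zero_add]
  have hzero : (0 : Cube n) ∈ K + K := by
    obtain ⟨a, ha⟩ := hne
    exact Finset.mem_add.2 ⟨a, ha, a, ha, cube_add_self a⟩
  refine ⟨⟨⟨⟨{x | x ∈ K + K}, fun {x y} hx hy => hadd x y hx hy⟩, hzero⟩, fun c x hx => ?_⟩,
    fun x => Iff.rfl⟩
  by_cases hc : c = 0
  · subst hc
    rw [zero_smul]
    exact hzero
  · rw [zmod_two_eq_one hc, one_smul]
    exact hx

/-- The number of points of `A` that translation by `h` moves out of `A`. -/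
noncomputable def defect {n : ℕ} (A : Finset (Cube n)) (h : Cube n) : ℕ := #{x ∈ A | x + h ∉ A}

lemma defect_add_le {n : ℕ} (A : Finset (Cube n)) (h h' : Cube n) :
    defect A (h + h') ≤ defect A h + defect A h' := by
  have hsub : {x ∈ A | x + (h + h') ∉ A} ⊆
      {x ∈ A | x + h ∉ A} ∪ ({x ∈ A | x + h' ∉ A}).image (· + h) := by
    intro x hx
    rw [Finset.mem_filter] at hx
    rw [Finset.mem_union, Finset.mem_filter, Finset.mem_image]
    by_cases hxh : x + h ∈ A
    · right
      refine ⟨x + h, Finset.mem_filter.2 ⟨hxh, ?_⟩, ?_⟩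
      · rw [add_assoc]; exact hx.2
      · rw [add_assoc, cube_add_self, add_zero]
    · exact Or.inl ⟨hx.1, hxh⟩
  exact (Finset.card_le_card hsub).trans ((Finset.card_union_le _ _).trans
    (Nat.add_le_add_left Finset.card_image_le _))

lemma sum_card_translates {n : ℕ} (A : Finset (Cube n)) :
    ∑ h, #{x ∈ A | x + h ∈ A} = #A * #A := by
  simp_rw [Finset.card_filter]
  rw [Finset.sum_comm]
  have : ∀ x ∈ A, ∑ h, (if x + h ∈ A then 1 else 0) = #A := fun x _ => by
    rw [← Finset.card_filter]
    refine Finset.card_bij' (fun h _ => x + h) (fun z _ => x + z) ?_ ?_ ?_ ?_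
    · intro h hh; simpa using hh
    · intro z hz; simpa [← add_assoc, cube_add_self] using hz
    · intro h _; simp [← add_assoc, cube_add_self]
    · intro z _; simp [← add_assoc, cube_add_self]
  rw [Finset.sum_congr rfl this, Finset.sum_const, smul_eq_mul]

/-- The triples that witness that `A` is not closed under sums of three elements. -/
noncomputable def badTriples {n : ℕ} (A : Finset (Cube n)) :
    Finset (Cube n × Cube n × Cube n) :=
  {p ∈ A ×ˢ A ×ˢ A | p.1 + p.2.1 + p.2.2 ∉ A}

lemma card_badTriples {n : ℕ} (A : Finset (Cube n)) :
    #(badTriples A) = ∑ y ∈ A, ∑ z ∈ A, defect A (y + z) := by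
  unfold badTriples defect
  rw [Finset.card_filter, Finset.sum_product]
  simp_rw [Finset.card_filter]
  refine Finset.sum_congr rfl fun y _ => ?_
  rw [Finset.sum_product]
  refine Finset.sum_congr rfl fun z _ => Finset.sum_congr rfl fun x _ => ?_
  have : x + (y + z) = y + z + x := by abel
  rw [this]

lemma exists_linearMap_ker_eq {n c : ℕ} (V : Submodule (ZMod 2) (Cube n))
    (hV : (2 : ℝ) ^ n ≤ c * Nat.card V) :
    ∃ ψ : Cube n →ₗ[ZMod 2] Cube c, ∀ x, ψ x = 0 ↔ x ∈ V := by
  have hcard := Submodule.card_eq_card_quotient_mul_card V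
  have hq : Nat.card (Cube n ⧸ V) = 2 ^ Module.finrank (ZMod 2) (Cube n ⧸ V) := by
    rw [Nat.card_eq_fintype_card, Module.card_eq_pow_finrank (K := ZMod 2), ZMod.card]
  have hVpos : 0 < Nat.card V := Nat.card_pos
  rw [Nat.card_eq_fintype_card, card_cube] at hcard
  have hcard' : (2 : ℝ) ^ n = Nat.card V * Nat.card (Cube n ⧸ V) := by exact_mod_cast hcard
  have hle : Nat.card (Cube n ⧸ V) ≤ c := by
    have hVpos' : (0 : ℝ) < Nat.card V := by exact_mod_cast hVpos
    have : (Nat.card (Cube n ⧸ V) : ℝ) ≤ c := by nlinarith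
    exact_mod_cast this
  have hfin : Module.finrank (ZMod 2) (Cube n ⧸ V) ≤ Module.finrank (ZMod 2) (Cube c) := by
    rw [Module.finrank_fin_fun]
    rw [hq] at hle
    exact (Nat.lt_two_pow_self).le.trans hle
  obtain ⟨ι, hι⟩ := finrank_le_iff_exists_linearMap.1 hfin
  refine ⟨ι ∘ₗ V.mkQ, fun x => ?_⟩
  rw [LinearMap.comp_apply, map_eq_zero_iff ι hι, Submodule.mkQ_apply,
    Submodule.Quotient.mk_eq_zero]

/-- A dense set with few bad triples is close to an affine subspace of bounded codimension. Most
translations by `y₀ + z` with `z ∈ A` nearly preserve `A`; they form a set of about the size of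
`A`, and so do the translations that are composed of two of them, because only `#A` translations
or so can nearly preserve `A`. Small doubling then yields a subspace. -/
lemma exists_affine_of_card_badTriples_le (t : ℕ) (ht : 0 < t) {s : ℝ} (hs : 0 < s) :
    ∃ δ : ℝ, 0 < δ ∧ ∀ (n : ℕ) (A : Finset (Cube n)), (2 : ℝ) ^ n ≤ t * #A →
      (#(badTriples A) : ℝ) ≤ δ * (2 ^ n) ^ 3 →
      ∃ (ψ : Cube n →ₗ[ZMod 2] Cube (2 * t)) (w : Cube (2 * t)),
        s * #{x | ¬(x ∈ A ↔ ψ x = w)} ≤ 2 ^ n := by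
  set η : ℝ := min (1 / 12) (1 / (6 * s)) with hη
  have hη0 : 0 < η := by rw [hη]; positivity
  have hη1 : η ≤ 1 / 12 := min_le_left _ _
  have hηs : s * (6 * η) ≤ 1 := by
    have h1 : η ≤ 1 / (6 * s) := min_le_right _ _
    rw [le_div_iff₀ (by positivity)] at h1
    linarith
  have ht' : (0 : ℝ) < t := by exact_mod_cast ht
  refine ⟨η ^ 2 / t ^ 3, by positivity, fun n A hA hbad => ?_⟩
  set N : ℝ := 2 ^ n with hN
  have hN0 : 0 < N := by positivity
  set a : ℝ := (#A : ℝ) with ha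
  have ha0 : 0 < a := by
    by_contra h
    have : a = 0 := le_antisymm (not_lt.1 h) (by positivity)
    rw [this] at hA
    linarith
  have haN : a ≤ N := by
    have := Finset.card_le_univ A
    rw [card_cube] at this
    rw [ha, hN]; exact_mod_cast this
  have hAne : A.Nonempty := Finset.card_pos.1 (Nat.cast_pos.1 ha0)
  have hbad' : ((#(badTriples A) : ℕ) : ℝ) ≤ η ^ 2 * a ^ 3 := by
    refine hbad.trans ?_
    calc η ^ 2 / t ^ 3 * N ^ 3 ≤ η ^ 2 / t ^ 3 * (t * a) ^ 3 := by gcongr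
      _ = η ^ 2 * a ^ 3 := by field_simp
  -- a translate for which the total defect is at most average
  obtain ⟨y₀, hy₀, hy₀sum⟩ : ∃ y₀ ∈ A, (∑ z ∈ A, (defect A (y₀ + z) : ℝ)) ≤ η ^ 2 * a ^ 2 := by
    refine Finset.exists_le_of_sum_le hAne ?_
    rw [Finset.sum_const, nsmul_eq_mul, ← ha]
    calc _ = ((#(badTriples A) : ℕ) : ℝ) := by rw [card_badTriples]; push_cast; rfl
      _ ≤ _ := hbad'
      _ = _ := by ring
  set A₀ : Finset (Cube n) := {z ∈ A | (defect A (y₀ + z) : ℝ) ≤ η * a} with hA₀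
  set K : Finset (Cube n) := A₀.image (y₀ + ·) with hK
  have hKcard : #K = #A₀ := Finset.card_image_of_injective _ (add_right_injective y₀)
  have hKge : (1 - η) * a ≤ #K := by
    rw [hKcard]
    have h1 : (#({z ∈ A | ¬(defect A (y₀ + z) : ℝ) ≤ η * a}) : ℝ) * (η * a) ≤ η ^ 2 * a ^ 2 := by
      refine le_trans ?_ hy₀sum
      rw [← nsmul_eq_mul, ← Finset.sum_const]
      refine le_trans (Finset.sum_le_sum fun z hz => (not_le.1 (Finset.mem_filter.1 hz).2).le) ?_
      exact Finset.sum_le_sum_of_subset_of_nonneg (Finset.filter_subset _ _)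
        fun _ _ _ => by positivity
    have h2 : (#({z ∈ A | ¬(defect A (y₀ + z) : ℝ) ≤ η * a}) : ℝ) ≤ η * a := by
      have : 0 < η * a := by positivity
      nlinarith
    have h3 := Finset.card_filter_add_card_filter_not (s := A)
      (fun z => (defect A (y₀ + z) : ℝ) ≤ η * a)
    have h4 : (#A₀ : ℝ) + #({z ∈ A | ¬(defect A (y₀ + z) : ℝ) ≤ η * a}) = a := by
      have h5 := congrArg (Nat.cast (R := ℝ)) h3
      rwa [Nat.cast_add] at h5
    linarith
  have hKdef : ∀ x ∈ K + K, (defect A x : ℝ) ≤ 2 * η * a := by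
    intro x hx
    obtain ⟨u, hu, v, hv, rfl⟩ := Finset.mem_add.1 hx
    obtain ⟨u', hu', rfl⟩ := Finset.mem_image.1 hu
    obtain ⟨v', hv', rfl⟩ := Finset.mem_image.1 hv
    have h1 := (Finset.mem_filter.1 hu').2
    have h2 := (Finset.mem_filter.1 hv').2
    have h3 : (defect A (y₀ + u' + (y₀ + v')) : ℝ) ≤
        defect A (y₀ + u') + defect A (y₀ + v') := by exact_mod_cast defect_add_le A _ _
    exact h3.trans (by linarith)
  have hKKcard : (#(K + K) : ℝ) ≤ (1 + 4 * η) * a := by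
    have h1 : ∀ x ∈ K + K, (1 - 2 * η) * a ≤ (#{u ∈ A | u + x ∈ A} : ℝ) := by
      intro x hx
      have h2 := Finset.card_filter_add_card_filter_not (s := A) (fun u => u + x ∈ A)
      have h3 : (#{u ∈ A | u + x ∈ A} : ℝ) + defect A x = a := by
        rw [ha, ← h2, defect]; push_cast; rfl
      have := hKdef x hx
      linarith
    have h2 : (#(K + K) : ℝ) * ((1 - 2 * η) * a) ≤ a * a := by
      rw [← nsmul_eq_mul, ← Finset.sum_const]
      refine (Finset.sum_le_sum h1).trans ?_
      have h4 := Finset.sum_le_sum_of_subset (f := fun x => #{u ∈ A | u + x ∈ A})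
        (Finset.subset_univ (K + K))
      rw [sum_card_translates] at h4
      rw [ha]; exact_mod_cast h4
    have h3 : (#(K + K) : ℝ) * (1 - 2 * η) ≤ a := by nlinarith
    have h4 : a ≤ (1 + 4 * η) * a * (1 - 2 * η) := by nlinarith [mul_pos hη0 ha0]
    have h5 : 0 < 1 - 2 * η := by linarith
    exact le_of_mul_le_mul_right (h3.trans h4) h5
  have hKne : K.Nonempty := by
    rw [← Finset.card_pos]
    have : (0 : ℝ) < #K := lt_of_lt_of_le (mul_pos (by linarith) ha0) hKge
    exact_mod_cast this
  obtain ⟨V, hV⟩ := exists_submodule_of_small_doubling hKne (by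
    have : (2 : ℝ) * #(K + K) < 3 * #K := by nlinarith
    exact_mod_cast this)
  have hVcard : Nat.card V = #(K + K) := by
    rw [Nat.card_eq_fintype_card]
    exact Fintype.card_of_subtype _ fun x => (hV x).symm
  have hKV : #K ≤ #(K + K) := Finset.card_le_card_add_right hKne
  have hKV' : (#K : ℝ) ≤ #(K + K) := by exact_mod_cast hKV
  obtain ⟨ψ, hψ⟩ := exists_linearMap_ker_eq (c := 2 * t) V (by
    rw [hVcard]; push_cast
    have : a ≤ 2 * #(K + K) := by nlinarith
    nlinarith)
  obtain ⟨z₀, hz₀⟩ : A₀.Nonempty := Finset.card_pos.1 (by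
    rw [← hKcard]; exact Finset.card_pos.2 hKne)
  refine ⟨ψ, ψ z₀, ?_⟩
  set C : Finset (Cube n) := {x | ψ x = ψ z₀} with hC
  have hCcard : #C = #(K + K) := by
    rw [hC, card_fiber_eq]
    congr 1
    ext x
    rw [Finset.mem_filter, hψ, hV]
    simp
  have hA₀C : A₀ ⊆ A ∩ C := by
    intro z hz
    refine Finset.mem_inter.2 ⟨(Finset.mem_filter.1 hz).1, Finset.mem_filter.2 ⟨mem_univ _, ?_⟩⟩
    have h1 : ψ (z + z₀) = 0 := by
      rw [hψ, hV]
      refine Finset.mem_add.2 ⟨y₀ + z, Finset.mem_image_of_mem _ hz, y₀ + z₀,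
        Finset.mem_image_of_mem _ hz₀, ?_⟩
      calc y₀ + z + (y₀ + z₀) = (y₀ + y₀) + (z + z₀) := by abel
        _ = _ := by rw [cube_add_self, zero_add]
    calc ψ z = ψ (z + z₀) + ψ z₀ := by
          rw [← map_add, add_assoc, cube_add_self, add_zero]
      _ = ψ z₀ := by rw [h1, zero_add]
  have hsub : ({x | ¬(x ∈ A ↔ ψ x = ψ z₀)} : Finset (Cube n)) ⊆ (A \ A₀) ∪ (C \ A₀) := by
    intro x hx
    rw [Finset.mem_filter] at hx
    have h0 : x ∈ A₀ → x ∈ A ∧ x ∈ C := fun h => Finset.mem_inter.1 (hA₀C h)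
    have h1 : x ∈ C ↔ ψ x = ψ z₀ := by simp [hC]
    rw [Finset.mem_union, Finset.mem_sdiff, Finset.mem_sdiff]
    tauto
  have h1 := (Finset.card_le_card hsub).trans (Finset.card_union_le _ _)
  have h2 := Finset.card_sdiff_add_card_eq_card (hA₀C.trans Finset.inter_subset_left)
  have h3 := Finset.card_sdiff_add_card_eq_card (hA₀C.trans Finset.inter_subset_right)
  rw [hCcard] at h3
  rw [← hKcard] at h2 h3
  have h1' : (#{x | ¬(x ∈ A ↔ ψ x = ψ z₀)} : ℝ) ≤ #(A \ A₀) + #(C \ A₀) := by exact_mod_cast h1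
  have h2' : (#(A \ A₀) : ℝ) + #K = a := by rw [ha]; exact_mod_cast h2
  have h3' : (#(C \ A₀) : ℝ) + #K = #(K + K) := by exact_mod_cast h3
  have h4 : (#{x | ¬(x ∈ A ↔ ψ x = ψ z₀)} : ℝ) ≤ 6 * η * a := by linarith
  calc s * (#{x | ¬(x ∈ A ↔ ψ x = ψ z₀)} : ℝ) ≤ s * (6 * η * a) := by gcongr
    _ = s * (6 * η) * a := by ring
    _ ≤ 1 * a := by gcongr
    _ ≤ N := by rwa [one_mul]

/-! ### Fourier analysis on `F_2^n` -/

/-- The nontrivial additive character of `F_2`, with real values. -/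
noncomputable def sgn (a : ZMod 2) : ℝ := if a = 0 then 1 else -1

lemma sgn_add (a b : ZMod 2) : sgn (a + b) = sgn a * sgn b := by
  have h : ∀ c : ZMod 2, c = 0 ∨ c = 1 := by decide
  rcases h a with rfl | rfl <;> rcases h b with rfl | rfl <;>
    simp [sgn, CharTwo.add_self_eq_zero]

lemma sgn_mul_self (a : ZMod 2) : sgn a * sgn a = 1 := by
  unfold sgn; split_ifs <;> norm_num

/-- The character of `F_2^n` with frequency `r`. -/
noncomputable def chi {n : ℕ} (r x : Cube n) : ℝ := sgn (r ⬝ᵥ x)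

lemma chi_add {n : ℕ} (r x y : Cube n) : chi r (x + y) = chi r x * chi r y := by
  rw [chi, dotProduct_add, sgn_add]; rfl

lemma sum_chi {n : ℕ} (x : Cube n) : ∑ r, chi r x = if x = 0 then (2 : ℝ) ^ n else 0 := by
  split_ifs with hx
  · subst hx
    simp [chi, sgn]
  · obtain ⟨i, hi⟩ := Function.ne_iff.1 hx
    have hflip : ∀ r : Cube n, chi (r + Pi.single i 1) x = -chi r x := fun r => by
      rw [chi, add_dotProduct, sgn_add, single_one_dotProduct]
      rw [show sgn (x i) = -1 from if_neg hi]
      rw [chi]; ring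
    have h := Equiv.sum_comp (Equiv.addRight (Pi.single i 1 : Cube n)) (fun r => chi r x)
    simp only [Equiv.coe_addRight, hflip, Finset.sum_neg_distrib] at h
    linarith

/-- The (unnormalized) Fourier transform. -/
noncomputable def hat {n : ℕ} (g : Cube n → ℝ) (r : Cube n) : ℝ := ∑ x, g x * chi r x

lemma sum_hat_mul_hat_mul_hat {n : ℕ} (p q g : Cube n → ℝ) (s : Cube n) :
    ∑ r, chi r s * (hat p r * hat q r * hat g r) =
      2 ^ n * ∑ u, ∑ v, p u * q v * g (s + u + v) := by
  have h1 : ∀ r, chi r s * (hat p r * hat q r * hat g r) =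
      ∑ u, ∑ v, ∑ w, p u * q v * g w * chi r (s + u + v + w) := fun r => by
    simp only [hat, chi_add]
    rw [Finset.sum_mul_sum, Finset.sum_mul, Finset.mul_sum]
    refine Finset.sum_congr rfl fun u _ => ?_
    rw [Finset.sum_mul, Finset.mul_sum]
    refine Finset.sum_congr rfl fun v _ => ?_
    rw [Finset.mul_sum, Finset.mul_sum]
    refine Finset.sum_congr rfl fun w _ => ?_
    ring
  simp_rw [h1]
  rw [Finset.sum_comm, Finset.mul_sum]
  refine Finset.sum_congr rfl fun u _ => ?_
  rw [Finset.sum_comm, Finset.mul_sum]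
  refine Finset.sum_congr rfl fun v _ => ?_
  rw [Finset.sum_comm]
  simp_rw [← Finset.mul_sum, sum_chi]
  rw [Finset.sum_eq_single (s + u + v)]
  · rw [if_pos (cube_add_self _)]; ring
  · intro w _ hw
    rw [if_neg, mul_zero]
    intro h
    apply hw
    calc w = (s + u + v + (s + u + v)) + w := by rw [cube_add_self, zero_add]
      _ = (s + u + v) + (s + u + v + w) := by abel
      _ = _ := by rw [h, add_zero]
  · exact fun h => absurd (mem_univ _) h

lemma sum_hat_sq {n : ℕ} (g : Cube n → ℝ) : ∑ r, hat g r ^ 2 = 2 ^ n * ∑ x, g x ^ 2 := by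
  have h1 : ∀ r, hat g r ^ 2 = ∑ u, ∑ v, g u * g v * chi r (u + v) := fun r => by
    simp only [hat, chi_add, sq, Finset.sum_mul_sum]
    refine Finset.sum_congr rfl fun u _ => Finset.sum_congr rfl fun v _ => ?_
    ring
  simp_rw [h1]
  rw [Finset.sum_comm, Finset.mul_sum]
  refine Finset.sum_congr rfl fun u _ => ?_
  rw [Finset.sum_comm]
  simp_rw [← Finset.mul_sum, sum_chi]
  rw [Finset.sum_eq_single u]
  · rw [if_pos (cube_add_self _)]; ring
  · intro v _ hv
    rw [if_neg, mul_zero]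
    intro h
    apply hv
    calc v = (u + u) + v := by rw [cube_add_self, zero_add]
      _ = u + (u + v) := by abel
      _ = u := by rw [h, add_zero]
  · exact fun h => absurd (mem_univ _) h

lemma abs_chi {n : ℕ} (r x : Cube n) : |chi r x| = 1 := by
  unfold chi sgn; split_ifs <;> simp

lemma sum_abs_hat_le {n : ℕ} {p q g : Cube n → ℝ} {B m : ℝ} (hp : ∀ r, |hat p r| ≤ B)
    (hq : ∑ x, q x ^ 2 ≤ m) (hg : ∑ x, g x ^ 2 ≤ m) :
    ∑ r, |hat p r| * |hat q r| * |hat g r| ≤ 2 ^ n * (B * m) := by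
  have hB : 0 ≤ B := (abs_nonneg _).trans (hp 0)
  have h1 : ∀ r, |hat p r| * |hat q r| * |hat g r| ≤ B / 2 * (hat q r ^ 2 + hat g r ^ 2) :=
    fun r => by
      have h2 : |hat q r| * |hat g r| ≤ (hat q r ^ 2 + hat g r ^ 2) / 2 := by
        have := sq_nonneg (|hat q r| - |hat g r|)
        have e1 := sq_abs (hat q r)
        have e2 := sq_abs (hat g r)
        nlinarith
      calc |hat p r| * |hat q r| * |hat g r| = |hat p r| * (|hat q r| * |hat g r|) := by ring
        _ ≤ B * ((hat q r ^ 2 + hat g r ^ 2) / 2) :=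
          mul_le_mul (hp r) h2 (by positivity) hB
        _ = _ := by ring
  refine (Finset.sum_le_sum fun r _ => h1 r).trans ?_
  rw [← Finset.mul_sum, Finset.sum_add_distrib, sum_hat_sq, sum_hat_sq]
  have hN : (0 : ℝ) < 2 ^ n := by positivity
  calc B / 2 * (2 ^ n * ∑ x, q x ^ 2 + 2 ^ n * ∑ x, g x ^ 2)
      ≤ B / 2 * (2 ^ n * m + 2 ^ n * m) := by gcongr
    _ = _ := by ring

/-- The weighted count of the solutions of `u + v + w = s`. -/
noncomputable def tripleSum {n : ℕ} (p q g : Cube n → ℝ) (s : Cube n) : ℝ :=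
  ∑ u, ∑ v, p u * q v * g (s + u + v)

lemma abs_tripleSum_le {n : ℕ} {p q g : Cube n → ℝ} {b : ℝ} (s : Cube n)
    (h : ∑ r, |hat p r| * |hat q r| * |hat g r| ≤ 2 ^ n * b) : |tripleSum p q g s| ≤ b := by
  have hN : (0 : ℝ) < 2 ^ n := by positivity
  have h1 := sum_hat_mul_hat_mul_hat p q g s
  have h2 : |∑ r, chi r s * (hat p r * hat q r * hat g r)| ≤ 2 ^ n * b := by
    refine (Finset.abs_sum_le_sum_abs _ _).trans (le_trans (le_of_eq ?_) h)
    refine Finset.sum_congr rfl fun r _ => ?_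
    rw [abs_mul, abs_chi, one_mul, abs_mul, abs_mul]
  rw [h1, abs_mul, abs_of_pos hN] at h2
  exact le_of_mul_le_mul_left h2 hN

/-- The indicator function of a finset. -/
noncomputable def ind {n : ℕ} (X : Finset (Cube n)) (x : Cube n) : ℝ := if x ∈ X then 1 else 0

lemma sum_ind_sq {n : ℕ} (X : Finset (Cube n)) : ∑ x, ind X x ^ 2 = #X := by
  simp [ind]

lemma tripleSum_ind {n : ℕ} (X₁ X₂ X₃ : Finset (Cube n)) (s : Cube n) :
    tripleSum (ind X₁) (ind X₂) (ind X₃) s = #{p ∈ X₁ ×ˢ X₂ | s + p.1 + p.2 ∈ X₃} := by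
  rw [Finset.card_filter, Finset.sum_product]
  simp only [tripleSum, ind]
  push_cast
  rw [← Finset.sum_subset (Finset.subset_univ X₁)]
  · refine Finset.sum_congr rfl fun u hu => ?_
    rw [← Finset.sum_subset (Finset.subset_univ X₂)]
    · refine Finset.sum_congr rfl fun v hv => ?_
      simp [hu, hv]
    · intro v _ hv; simp [hv]
  · intro u _ hu; simp [hu]

/-- Counting `u + v + w = s` in sets `X₁, X₂, X₃` that have no large Fourier coefficient relative
to the fibres of `ψ` that contain them. -/
lemma le_card_triples_of_regular {n c : ℕ} (ψ : Cube n →ₗ[ZMod 2] Cube c) {y : Fin 3 → Cube c}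
    {X : Fin 3 → Finset (Cube n)} (hX : ∀ i, ∀ x ∈ X i, ψ x = y i) {α : Fin 3 → ℝ}
    (hα : ∀ i, 0 < α i) (hα1 : ∀ i, α i ≤ 1) (hαX : ∀ i, α i * #{x | ψ x = y i} = #(X i))
    {η : ℝ}
    (hreg : ∀ i r, |hat (fun x => ind (X i) x - α i * ind ({x | ψ x = y i} : Finset (Cube n)) x) r|
      ≤ η * #{x | ψ x = 0}) (hne : ∀ i, (X i).Nonempty) {s : Cube n}
    (hs : ψ s = y 0 + y 1 + y 2) :
    (α 0 * α 1 * α 2 - 3 * η) * (#{x | ψ x = 0} : ℝ) ^ 2 ≤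
      (#{p ∈ X 0 ×ˢ X 1 | s + p.1 + p.2 ∈ X 2} : ℝ) := by
  set m : ℝ := (#{x | ψ x = 0} : ℝ) with hm
  have hm0 : 0 ≤ m := by positivity
  set V : Fin 3 → Finset (Cube n) := fun i => {x | ψ x = y i} with hV
  have hVm : ∀ i, (#(V i) : ℝ) = m := fun i => by
    obtain ⟨x₀, hx₀⟩ := hne i
    rw [hV, hm]
    simp only
    rw [← hX i x₀ hx₀, card_fiber_eq]
  have hVsq : ∀ i, ∑ x, ind (V i) x ^ 2 ≤ m := fun i => by rw [sum_ind_sq, hVm]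
  have hXsq : ∀ i, ∑ x, ind (X i) x ^ 2 ≤ m := fun i => by
    rw [sum_ind_sq, ← hαX i, show (#{x | ψ x = y i} : ℝ) = m from hVm i]
    exact mul_le_of_le_one_left hm0 (hα1 i)
  set h : Fin 3 → Cube n → ℝ := fun i x => ind (X i) x - α i * ind (V i) x with hh
  have b0 : |tripleSum (h 0) (ind (X 1)) (ind (X 2)) s| ≤ η * m * m :=
    abs_tripleSum_le s (sum_abs_hat_le (hreg 0) (hXsq 1) (hXsq 2))
  have b1 : |tripleSum (ind (V 0)) (h 1) (ind (X 2)) s| ≤ η * m * m := by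
    refine abs_tripleSum_le s ?_
    simp_rw [mul_comm |hat (ind (V 0)) _|]
    exact sum_abs_hat_le (hreg 1) (hVsq 0) (hXsq 2)
  have b2 : |tripleSum (ind (V 0)) (ind (V 1)) (h 2) s| ≤ η * m * m := by
    refine abs_tripleSum_le s (le_trans (le_of_eq ?_)
      (sum_abs_hat_le (hreg 2) (hVsq 0) (hVsq 1)))
    exact Finset.sum_congr rfl fun r _ => (mul_rotate _ _ _).symm
  have bV : tripleSum (ind (V 0)) (ind (V 1)) (ind (V 2)) s = m ^ 2 := by
    rw [tripleSum_ind, Finset.filter_true_of_mem, Finset.card_product]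
    · push_cast; rw [hVm, hVm, sq]
    · intro p hp
      simp only [hV, mem_product, mem_filter, mem_univ, true_and] at hp ⊢
      rw [map_add, map_add, hs, hp.1, hp.2]
      calc _ = (y 0 + y 0) + (y 1 + y 1) + y 2 := by abel
        _ = _ := by rw [cube_add_self, cube_add_self, zero_add, zero_add]
  have hdecomp : tripleSum (ind (X 0)) (ind (X 1)) (ind (X 2)) s =
      tripleSum (h 0) (ind (X 1)) (ind (X 2)) s
      + α 0 * tripleSum (ind (V 0)) (h 1) (ind (X 2)) s
      + α 0 * α 1 * tripleSum (ind (V 0)) (ind (V 1)) (h 2) s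
      + α 0 * α 1 * α 2 * tripleSum (ind (V 0)) (ind (V 1)) (ind (V 2)) s := by
    simp only [tripleSum, Finset.mul_sum, ← Finset.sum_add_distrib, hh]
    refine Finset.sum_congr rfl fun u _ => Finset.sum_congr rfl fun v _ => ?_
    ring
  rw [← tripleSum_ind, hdecomp, bV]
  have hηm : 0 ≤ η * m * m := (abs_nonneg _).trans b0
  have c1 : -(η * m * m) ≤ α 0 * tripleSum (ind (V 0)) (h 1) (ind (X 2)) s := by
    have := (abs_le.1 b1).1
    nlinarith [hα 0, hα1 0]
  have c2 : -(η * m * m) ≤ α 0 * α 1 * tripleSum (ind (V 0)) (ind (V 1)) (h 2) s := by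
    have := (abs_le.1 b2).1
    have h01 : 0 < α 0 * α 1 := mul_pos (hα 0) (hα 1)
    have h01' : α 0 * α 1 ≤ 1 := mul_le_one₀ (hα1 0) (hα 1).le (hα1 1)
    nlinarith
  have := (abs_le.1 b0).1
  linarith [this, c1, c2]

/-! ### The arithmetic regularity lemma -/

/-- The average of `G` over the fibre of `ψ` above `y`, and `0` for an empty fibre. -/
noncomputable def avg {n c : ℕ} (ψ : Cube n →ₗ[ZMod 2] Cube c) (G : Cube n → ℝ) (y : Cube c) : ℝ :=
  (∑ x with ψ x = y, G x) / #{x | ψ x = y}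

lemma avg_mul_card {n c : ℕ} (ψ : Cube n →ₗ[ZMod 2] Cube c) (G : Cube n → ℝ) (y : Cube c) :
    avg ψ G y * #{x | ψ x = y} = ∑ x with ψ x = y, G x := by
  unfold avg
  by_cases h : ({x | ψ x = y} : Finset (Cube n)) = ∅
  · rw [h]; simp
  · exact div_mul_cancel₀ _ (by simpa using h)

lemma avg_nonneg {n c : ℕ} (ψ : Cube n →ₗ[ZMod 2] Cube c) {G : Cube n → ℝ} (hG : ∀ x, 0 ≤ G x)
    (y : Cube c) : 0 ≤ avg ψ G y :=
  div_nonneg (Finset.sum_nonneg fun x _ => hG x) (by positivity)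

lemma avg_le_one {n c : ℕ} (ψ : Cube n →ₗ[ZMod 2] Cube c) {G : Cube n → ℝ} (hG : ∀ x, G x ≤ 1)
    (y : Cube c) : avg ψ G y ≤ 1 := by
  refine div_le_one_of_le₀ ?_ (by positivity)
  refine (Finset.sum_le_sum fun x _ => hG x).trans ?_
  simp

/-- `avg ψ G ∘ ψ` is the orthogonal projection of `G` to the functions of `ψ`. -/
lemma sum_mul_comp {n c : ℕ} (ψ : Cube n →ₗ[ZMod 2] Cube c) (G : Cube n → ℝ) (k : Cube c → ℝ) :
    ∑ x, G x * k (ψ x) = ∑ x, avg ψ G (ψ x) * k (ψ x) := by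
  rw [← Finset.sum_fiberwise (s := univ) (g := ψ), ← Finset.sum_fiberwise (s := univ) (g := ψ)
    (f := fun x => avg ψ G (ψ x) * k (ψ x))]
  refine Finset.sum_congr rfl fun y _ => ?_
  have e1 : ∑ x with ψ x = y, G x * k (ψ x) = (∑ x with ψ x = y, G x) * k y := by
    rw [Finset.sum_mul]
    exact Finset.sum_congr rfl fun x hx => by rw [(Finset.mem_filter.1 hx).2]
  have e2 : ∑ x with ψ x = y, avg ψ G (ψ x) * k (ψ x) =
      ∑ x with ψ x = y, avg ψ G y * k y :=
    Finset.sum_congr rfl fun x hx => by rw [(Finset.mem_filter.1 hx).2]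
  rw [e1, e2, Finset.sum_const, nsmul_eq_mul, ← avg_mul_card]
  ring

/-- On the fibre above `y`, the deviation of `G` from its average has no Fourier coefficient
larger than `η` times the size of the fibre. -/
def IsRegular {n c : ℕ} (ψ : Cube n →ₗ[ZMod 2] Cube c) (G : Cube n → ℝ) (η : ℝ) (y : Cube c) :
    Prop :=
  ∀ r, |∑ x with ψ x = y, (G x - avg ψ G y) * chi r x| ≤ η * #{x | ψ x = y}

/-- The energy of the partition of `F_2^n` into the fibres of `ψ`. -/
noncomputable def energy {n c : ℕ} (ψ : Cube n →ₗ[ZMod 2] Cube c) (G : Cube n → ℝ) : ℝ :=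
  ∑ x, avg ψ G (ψ x) ^ 2

lemma energy_le {n c : ℕ} (ψ : Cube n →ₗ[ZMod 2] Cube c) {G : Cube n → ℝ} (hG : ∀ x, 0 ≤ G x)
    (hG1 : ∀ x, G x ≤ 1) : energy ψ G ≤ 2 ^ n := by
  refine (Finset.sum_le_sum (g := fun _ => (1 : ℝ)) fun x _ => ?_).trans ?_
  · exact pow_le_one₀ (avg_nonneg ψ hG _) (avg_le_one ψ hG1 _)
  · simp

/-- The linear functional `x ↦ r ⬝ᵥ x`. -/
def dotLin {n : ℕ} (r : Cube n) : Cube n →ₗ[ZMod 2] ZMod 2 where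
  toFun x := r ⬝ᵥ x
  map_add' := dotProduct_add r
  map_smul' a x := dotProduct_smul a r x

/-- Adding, for each irregular fibre, the frequency of a large Fourier coefficient to the linear
forms increases the energy. -/
lemma energy_increment {n c : ℕ} (ψ : Cube n →ₗ[ZMod 2] Cube c) (G : Cube n → ℝ) {η ε : ℝ}
    (hη : 0 < η) (hε : 0 < ε) (hirr : ε * 2 ^ n ≤ #{x | ¬IsRegular ψ G η (ψ x)}) :
    ∃ ψ' : Cube n →ₗ[ZMod 2] Cube (c + 2 ^ c), energy ψ G + (η * ε) ^ 2 * 2 ^ n ≤ energy ψ' G := by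
  have hex : ∀ y, ∃ r, ¬IsRegular ψ G η y →
      η * #{x | ψ x = y} ≤ |∑ x with ψ x = y, (G x - avg ψ G y) * chi r x| := fun y => by
    by_cases hy : IsRegular ψ G η y
    · exact ⟨0, fun h => absurd hy h⟩
    · unfold IsRegular at hy
      push Not at hy
      obtain ⟨r, hr⟩ := hy
      exact ⟨r, fun _ => hr.le⟩
  choose r hr using hex
  set Ψ : Cube n →ₗ[ZMod 2] (Cube c × (Cube c → ZMod 2)) :=
    ψ.prod (LinearMap.pi fun y => dotLin (r y)) with hΨ
  have hrank : Module.finrank (ZMod 2) (Cube c × (Cube c → ZMod 2)) =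
      Module.finrank (ZMod 2) (Cube (c + 2 ^ c)) := by
    rw [Module.finrank_prod, Module.finrank_fin_fun, Module.finrank_fin_fun,
      Module.finrank_fintype_fun_eq_card, card_cube]
  set e := LinearEquiv.ofFinrankEq _ _ hrank with he
  set ψ' : Cube n →ₗ[ZMod 2] Cube (c + 2 ^ c) := e.toLinearMap ∘ₗ Ψ with hψ'
  have hsymm : ∀ x, e.symm (ψ' x) = (ψ x, fun y => r y ⬝ᵥ x) := fun x => by
    rw [hψ', LinearMap.comp_apply, LinearEquiv.coe_coe, LinearEquiv.symm_apply_apply]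
    rfl
  set N : ℝ := 2 ^ n with hN
  have hN0 : 0 < N := by positivity
  set a : Cube n → ℝ := fun x => avg ψ G (ψ x) with ha
  set a' : Cube n → ℝ := fun x => avg ψ' G (ψ' x) with ha'
  -- functions of `ψ` are functions of `ψ'`
  have hproj : ∀ k : Cube c → ℝ, ∑ x, G x * k (ψ x) = ∑ x, a' x * k (ψ x) := fun k => by
    have := sum_mul_comp ψ' G (fun z => k (e.symm z).1)
    simpa only [hsymm] using this
  have hpyth : energy ψ' G = energy ψ G + ∑ x, (a' x - a x) ^ 2 := by
    have e1 := hproj (avg ψ G)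
    have e2 := sum_mul_comp ψ G (avg ψ G)
    have e3 : ∑ x, a' x * a x = ∑ x, a x * a x := e1.symm.trans e2
    simp only [energy]
    have e4 : ∑ x, (a' x - a x) ^ 2 = ∑ x, a' x ^ 2 - 2 * ∑ x, a' x * a x + ∑ x, a x * a x := by
      rw [Finset.mul_sum, ← Finset.sum_sub_distrib, ← Finset.sum_add_distrib]
      exact Finset.sum_congr rfl fun x _ => by ring
    have e5 : ∑ x, a x * a x = ∑ x, avg ψ G (ψ x) ^ 2 :=
      Finset.sum_congr rfl fun x _ => by rw [ha, sq]
    rw [e4, e3, e5]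
    ring
  set c₀ : Cube c → ℝ := fun y => ∑ x with ψ x = y, (G x - avg ψ G y) * chi (r y) x with hc₀
  set sg : Cube c → ℝ := fun y => if IsRegular ψ G η y then 0 else if 0 ≤ c₀ y then 1 else -1
    with hsg
  set K : Cube n → ℝ := fun x => sg (ψ x) * chi (r (ψ x)) x with hK
  have hKsq : ∀ x, K x ^ 2 ≤ 1 := fun x => by
    have : chi (r (ψ x)) x ^ 2 = 1 := by rw [sq]; exact sgn_mul_self _
    simp only [hK, hsg, mul_pow, this]
    split_ifs <;> norm_num
  have hKproj : ∑ x, G x * K x = ∑ x, a' x * K x := by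
    have := sum_mul_comp ψ' G
      (fun z => sg (e.symm z).1 * sgn ((e.symm z).2 (e.symm z).1))
    simp only [hsymm] at this
    exact this
  have hcorr : η * ε * N ≤ ∑ x, (a' x - a x) * K x := by
    have e1 : ∑ x, (a' x - a x) * K x = ∑ x, (G x - a x) * K x := by
      simp_rw [sub_mul]
      rw [Finset.sum_sub_distrib, Finset.sum_sub_distrib, hKproj]
    have e2 : ∑ x, (G x - a x) * K x = ∑ y, sg y * c₀ y := by
      rw [← Finset.sum_fiberwise (s := univ) (g := ψ)]
      refine Finset.sum_congr rfl fun y _ => ?_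
      rw [hc₀, Finset.mul_sum]
      refine Finset.sum_congr rfl fun x hx => ?_
      simp only [hK, ha, (Finset.mem_filter.1 hx).2]
      ring
    have e3 : ∀ y, (if IsRegular ψ G η y then 0 else η * #{x | ψ x = y}) ≤ sg y * c₀ y := by
      intro y
      simp only [hsg]
      split_ifs with h1 h2
      · simp
      · rw [one_mul, ← abs_of_nonneg h2]; exact hr y h1
      · rw [neg_one_mul, ← abs_of_neg (not_le.1 h2)]; exact hr y h1
    rw [e1, e2]
    refine le_trans ?_ (Finset.sum_le_sum fun y _ => e3 y)
    have e4 : (#{x | ¬IsRegular ψ G η (ψ x)} : ℝ) =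
        ∑ y, if IsRegular ψ G η y then (0 : ℝ) else #{x | ψ x = y} := by
      rw [Finset.card_filter]
      push_cast
      rw [← Finset.sum_fiberwise (s := univ) (g := ψ)]
      refine Finset.sum_congr rfl fun y _ => ?_
      rw [Finset.sum_congr rfl (g := fun _ => if IsRegular ψ G η y then (0 : ℝ) else 1)]
      · rw [Finset.sum_const, nsmul_eq_mul]; split_ifs <;> simp
      · intro x hx
        rw [(Finset.mem_filter.1 hx).2]
        by_cases h : IsRegular ψ G η y <;> simp [h]
    calc η * ε * N = η * (ε * N) := by ring
      _ ≤ η * #{x | ¬IsRegular ψ G η (ψ x)} := by gcongr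
      _ = _ := by
        rw [e4, Finset.mul_sum]
        refine Finset.sum_congr rfl fun y _ => ?_
        split_ifs <;> simp
  have hCS := Finset.sum_mul_sq_le_sq_mul_sq univ (fun x => a' x - a x) K
  have hKN : ∑ x, K x ^ 2 ≤ N := by
    refine (Finset.sum_le_sum fun x _ => hKsq x).trans ?_
    simp [hN]
  refine ⟨ψ', ?_⟩
  rw [hpyth]
  have hD0 : 0 ≤ ∑ x, (a' x - a x) ^ 2 := Finset.sum_nonneg fun _ _ => sq_nonneg _
  have h1 : (η * ε * N) ^ 2 ≤ (∑ x, (a' x - a x) * K x) ^ 2 :=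
    pow_le_pow_left₀ (by positivity) hcorr 2
  have h2 : (η * ε) ^ 2 * N * N ≤ (∑ x, (a' x - a x) ^ 2) * N := by
    calc (η * ε) ^ 2 * N * N = (η * ε * N) ^ 2 := by ring
      _ ≤ _ := h1.trans (hCS.trans (by gcongr))
  have h3 := le_of_mul_le_mul_right h2 hN0
  linarith

/-- The codimensions reached by iterating `energy_increment`. -/
def codimSeq : ℕ → ℕ
  | 0 => 0
  | i + 1 => codimSeq i + 2 ^ codimSeq i

lemma exists_regular (η ε : ℝ) (hη : 0 < η) (hε : 0 < ε) :
    ∃ C : ℕ, ∀ (n : ℕ) (G : Cube n → ℝ), (∀ x, 0 ≤ G x) → (∀ x, G x ≤ 1) →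
      ∃ c ≤ C, ∃ ψ : Cube n →ₗ[ZMod 2] Cube c,
        (#{x | ¬IsRegular ψ G η (ψ x)} : ℝ) ≤ ε * 2 ^ n := by
  obtain ⟨I, hI⟩ := exists_nat_gt (1 / (η * ε) ^ 2)
  refine ⟨codimSeq I, fun n G hG hG1 => ?_⟩
  have hN : (0 : ℝ) < 2 ^ n := by positivity
  have key : ∀ i, (∃ c ≤ codimSeq i, ∃ ψ : Cube n →ₗ[ZMod 2] Cube c,
      (#{x | ¬IsRegular ψ G η (ψ x)} : ℝ) ≤ ε * 2 ^ n) ∨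
      ∃ ψ : Cube n →ₗ[ZMod 2] Cube (codimSeq i), i * ((η * ε) ^ 2 * 2 ^ n) ≤ energy ψ G := by
    intro i
    induction i with
    | zero =>
      refine Or.inr ⟨0, ?_⟩
      rw [Nat.cast_zero, zero_mul]
      exact Finset.sum_nonneg fun _ _ => sq_nonneg _
    | succ i ih =>
      rcases ih with ⟨c, hc, ψ, hψ⟩ | ⟨ψ, hψ⟩
      · exact Or.inl ⟨c, hc.trans (Nat.le_add_right _ _), ψ, hψ⟩
      · by_cases hreg : (#{x | ¬IsRegular ψ G η (ψ x)} : ℝ) ≤ ε * 2 ^ n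
        · exact Or.inl ⟨_, Nat.le_add_right _ _, ψ, hreg⟩
        · obtain ⟨ψ', hψ'⟩ := energy_increment ψ G hη hε (not_le.1 hreg).le
          refine Or.inr ⟨ψ', le_trans ?_ hψ'⟩
          push_cast
          linarith
  rcases key I with h | ⟨ψ, hψ⟩
  · exact h
  · exfalso
    have h1 := hψ.trans (energy_le ψ hG hG1)
    rw [div_lt_iff₀ (by positivity)] at hI
    nlinarith

/-! ### Families whose patterns use one value -/

/-- The indicator function of `f⁻¹(v)`. -/
noncomputable def level {n : ℕ} (f : BoolFun n) (v : Bool) : Cube n → ℝ := ind {x | f x = v}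

lemma level_nonneg {n : ℕ} (f : BoolFun n) (v : Bool) (x : Cube n) : 0 ≤ level f v x := by
  unfold level ind; split_ifs <;> norm_num

lemma level_le_one {n : ℕ} (f : BoolFun n) (v : Bool) (x : Cube n) : level f v x ≤ 1 := by
  unfold level ind; split_ifs <;> norm_num

/-- The fibres in which `f⁻¹(v)` is regular and has density at least `a`. -/
noncomputable def goodFibers {n c : ℕ} (ψ : Cube n →ₗ[ZMod 2] Cube c) (f : BoolFun n) (v : Bool)
    (η a : ℝ) : Finset (Cube c) :=
  {y | IsRegular ψ (level f v) η y ∧ a ≤ avg ψ (level f v) y}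

/-- Few points of `f⁻¹(v)` lie outside the good fibres. -/
lemma card_outside_goodFibers_le {n c : ℕ} (ψ : Cube n →ₗ[ZMod 2] Cube c) (f : BoolFun n)
    (v : Bool) {η a : ℝ} (ha : 0 ≤ a)
    (hirr : (#{x | ¬IsRegular ψ (level f v) η (ψ x)} : ℝ) ≤ a * 2 ^ n) :
    (#{x | f x = v ∧ ψ x ∉ goodFibers ψ f v η a} : ℝ) ≤ 2 * a * 2 ^ n := by
  set G := level f v with hG
  set k : Cube c → ℝ := fun y => if avg ψ G y < a then 1 else 0 with hk
  have hsub : ({x | f x = v ∧ ψ x ∉ goodFibers ψ f v η a} : Finset (Cube n)) ⊆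
      ({x | ¬IsRegular ψ G η (ψ x)} : Finset (Cube n)) ∪
        ({x | f x = v ∧ avg ψ G (ψ x) < a} : Finset (Cube n)) := by
    intro x hx
    simp only [goodFibers, mem_filter, mem_univ, true_and, Finset.mem_union, not_and,
      not_le] at hx ⊢
    by_cases h : IsRegular ψ G η (ψ x)
    · exact Or.inr ⟨hx.1, hx.2 h⟩
    · exact Or.inl h
  have h1 := (Finset.card_le_card hsub).trans (Finset.card_union_le _ _)
  have h1' : (#{x | f x = v ∧ ψ x ∉ goodFibers ψ f v η a} : ℝ) ≤
      #{x | ¬IsRegular ψ G η (ψ x)} + #{x | f x = v ∧ avg ψ G (ψ x) < a} := by exact_mod_cast h1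
  have h2 : (#{x | f x = v ∧ avg ψ G (ψ x) < a} : ℝ) = ∑ x, G x * k (ψ x) := by
    rw [Finset.card_filter]
    push_cast
    refine Finset.sum_congr rfl fun x _ => ?_
    by_cases h3 : f x = v <;> by_cases h4 : avg ψ G (ψ x) < a <;> simp [hG, level, ind, hk, h3]
  have h5 : ∑ x, G x * k (ψ x) ≤ a * 2 ^ n := by
    rw [sum_mul_comp]
    refine (Finset.sum_le_sum (g := fun _ => a) fun x _ => ?_).trans ?_
    · simp only [hk]
      split_ifs with h
      · rw [mul_one]; exact h.le
      · rw [mul_zero]; exact ha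
    · simp [mul_comm]
  linarith

lemma avg_level_mul_card {n c : ℕ} (ψ : Cube n →ₗ[ZMod 2] Cube c) (f : BoolFun n) (v : Bool)
    (y : Cube c) : avg ψ (level f v) y * #{x | ψ x = y} = #{x | ψ x = y ∧ f x = v} := by
  rw [avg_mul_card, ← Finset.filter_filter, Finset.card_filter]
  push_cast
  exact Finset.sum_congr rfl fun x _ => by simp [level, ind]

lemma card_fiber_eq_ker_of_goodFibers {n c : ℕ} {ψ : Cube n →ₗ[ZMod 2] Cube c} {f : BoolFun n}
    {v : Bool} {η a : ℝ} (ha : 0 < a) {y : Cube c} (hy : y ∈ goodFibers ψ f v η a) :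
    (∃ x, ψ x = y ∧ f x = v) ∧ #{x | ψ x = y} = #{x | ψ x = 0} := by
  simp only [goodFibers, mem_filter, mem_univ, true_and] at hy
  have hpos : 0 < avg ψ (level f v) y := ha.trans_le hy.2
  have hne : ({x | ψ x = y} : Finset (Cube n)).Nonempty := by
    by_contra h
    rw [Finset.not_nonempty_iff_eq_empty] at h
    unfold avg at hpos
    rw [h] at hpos
    simp at hpos
  have h1 := avg_level_mul_card ψ f v y
  have h2 : (0 : ℝ) < #{x | ψ x = y ∧ f x = v} := by
    rw [← h1]
    exact mul_pos hpos (by exact_mod_cast Finset.card_pos.2 hne)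
  have h3 : 0 < #{x | ψ x = y ∧ f x = v} := by exact_mod_cast h2
  obtain ⟨x, hx⟩ := Finset.card_pos.1 h3
  have hx' := (Finset.mem_filter.1 hx).2
  exact ⟨⟨x, hx'⟩, by rw [← hx'.1, card_fiber_eq]⟩

/-- Many solutions above a solution in the good fibres. -/
lemma le_card_triples_goodFibers {n c : ℕ} (ψ : Cube n →ₗ[ZMod 2] Cube c) (f : BoolFun n)
    (v : Bool) {a : ℝ} (ha : 0 < a) {y : Fin 3 → Cube c}
    (hy : ∀ i, y i ∈ goodFibers ψ f v (a ^ 3 / 6) a) {s : Cube n} (hs : ψ s = y 0 + y 1 + y 2) :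
    a ^ 3 / 2 * (#{x | ψ x = 0} : ℝ) ^ 2 ≤
      (#{p ∈ ({x | ψ x = y 0 ∧ f x = v} : Finset (Cube n)) ×ˢ
        ({x | ψ x = y 1 ∧ f x = v} : Finset (Cube n)) |
        s + p.1 + p.2 ∈ ({x | ψ x = y 2 ∧ f x = v} : Finset (Cube n))} : ℝ) := by
  set α : Fin 3 → ℝ := fun i => avg ψ (level f v) (y i) with hα
  have hgood := fun i => (Finset.mem_filter.1 (hy i)).2
  have hα0 : ∀ i, a ≤ α i := fun i => (hgood i).2
  have key := le_card_triples_of_regular ψ (y := y)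
    (X := fun i => ({x | ψ x = y i ∧ f x = v} : Finset (Cube n)))
    (fun i x hx => (Finset.mem_filter.1 hx).2.1) (α := α)
    (fun i => ha.trans_le (hα0 i)) (fun i => avg_le_one ψ (level_le_one f v) _)
    (fun i => avg_level_mul_card ψ f v (y i)) (η := a ^ 3 / 6) (fun i r => ?_) (fun i => ?_) hs
  · refine le_trans ?_ key
    have h01 : a * a ≤ α 0 * α 1 :=
      mul_le_mul (hα0 0) (hα0 1) ha.le (ha.le.trans (hα0 0))
    have h012 : a * a * a ≤ α 0 * α 1 * α 2 :=
      mul_le_mul h01 (hα0 2) ha.le ((mul_pos ha ha).le.trans h01)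
    gcongr
    nlinarith
  · have h1 := (hgood i).1 r
    rw [(card_fiber_eq_ker_of_goodFibers ha (hy i)).2] at h1
    refine le_trans (le_of_eq ?_) h1
    congr 1
    rw [Finset.sum_filter, hat]
    refine Finset.sum_congr rfl fun x _ => ?_
    by_cases h2 : ψ x = y i <;> simp [ind, level, hα, h2]
  · obtain ⟨x, hx⟩ := (card_fiber_eq_ker_of_goodFibers ha (hy i)).1
    exact ⟨x, Finset.mem_filter.2 ⟨mem_univ _, hx⟩⟩

/-- If all occurring variables of all patterns have the same value `v`, then the part of `f⁻¹(v)`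
outside the good fibres may be deleted. If `f` is far from `F`-free, some pattern survives, and it
yields a solution in the good fibres, where it can be counted. For given codimension there are
finitely many sets of good fibres; this bounds the number of equations that are needed even if
`F` is infinite. -/
lemma eventually_rejects_of_same_value {F : Set InducedSystem} (hF : ∀ S ∈ F, S.IsSingleEquation)
    {v : Bool} (hv : ∀ S ∈ F, ∀ j ∈ occ S, S.σ j = v) {ε : ℝ} (hε : 0 < ε) {t : ℕ} (ht : 0 < t) :
    ∀ᶠ q : ℕ in atTop, ∀ (n : ℕ) (f : BoolFun n), (∀ w, (2 : ℝ) ^ n ≤ t * #{x | f x = w}) →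
      IsFarFrom ε (familyFree F) f → Rejects F q f := by
  set a : ℝ := ε / 3 with ha
  have ha0 : 0 < a := by positivity
  obtain ⟨C, hC⟩ := exists_regular (a ^ 3 / 6) a (by positivity) ha0
  suffices h : ∀ (c : ℕ) (Y : Finset (Cube c)), ∀ᶠ q : ℕ in atTop, ∀ (n : ℕ) (f : BoolFun n)
      (ψ : Cube n →ₗ[ZMod 2] Cube c),
      (#{x | ¬IsRegular ψ (level f v) (a ^ 3 / 6) (ψ x)} : ℝ) ≤ a * 2 ^ n →
      goodFibers ψ f v (a ^ 3 / 6) a = Y → (∀ w, (2 : ℝ) ^ n ≤ t * #{x | f x = w}) →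
      IsFarFrom ε (familyFree F) f → Rejects F q f by
    have h' := (Filter.eventually_all_finset (Finset.range (C + 1))).2
      fun c _ => Filter.eventually_all.2 (h c)
    filter_upwards [h'] with q hq n f hdense hfar
    obtain ⟨c, hc, ψ, hψ⟩ := hC n (level f v) (level_nonneg f v) (level_le_one f v)
    exact hq c (Finset.mem_range.2 (Nat.lt_succ_of_le hc)) _ n f ψ hψ rfl hdense hfar
  intro c Y
  by_cases hex : ∃ S ∈ F, ∃ y : Fin S.k → Cube c, (∀ j ∈ occ S, y j ∈ Y) ∧ ∑ j ∈ occ S, y j = 0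
  · obtain ⟨S, hSF, y, hyY, hy0⟩ := hex
    have hS := hF S hSF
    obtain ⟨j₁, j₂, j₃, h₁, h₂, h₃, h₁₂, h₁₃, h₂₃⟩ := exists_three_occ hS
    set κ : ℝ := 1 / 2 ^ c with hκ
    have hκ0 : 0 < κ := by positivity
    have ht' : (0 : ℝ) < t := by exact_mod_cast ht
    set θ : ℝ := min (min (a * κ) (1 / t)) (a ^ 3 / 2 * κ ^ 2) with hθ
    have hθ0 : 0 < θ := by rw [hθ]; positivity
    have hθ1 : θ ≤ a * κ := (min_le_left _ _).trans (min_le_left _ _)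
    have hθ2 : θ ≤ 1 / t := (min_le_left _ _).trans (min_le_right _ _)
    have hθ3 : θ ≤ a ^ 3 / 2 * κ ^ 2 := min_le_right _ _
    filter_upwards [eventually_rejects F S.k (pow_pos hθ0 (S.k - 2))]
      with q hq n f ψ _ hYeq hdense _
    refine hq n f ?_
    subst hYeq
    set m : ℝ := (#{x | ψ x = 0} : ℝ) with hm
    have hN : (0 : ℝ) < 2 ^ n := by positivity
    have hmN : κ * 2 ^ n ≤ m := by
      rw [hκ, div_mul_eq_mul_div, one_mul, div_le_iff₀ (by positivity), mul_comm]
      exact two_pow_le_card_ker ψ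
    set X : Fin S.k → Finset (Cube n) := fun j =>
      if j ∈ occ S then ({x | ψ x = y j ∧ f x = v} : Finset (Cube n))
      else ({x | f x = S.σ j} : Finset (Cube n)) with hX
    have hXocc : ∀ j ∈ occ S, X j = ({x | ψ x = y j ∧ f x = v} : Finset (Cube n)) :=
      fun j hj => if_pos hj
    have hXnot : ∀ j ∉ occ S, X j = ({x | f x = S.σ j} : Finset (Cube n)) :=
      fun j hj => if_neg hj
    refine le_rejFrac_of_count hSF hS ψ y hy0 X (fun j x hx => ?_) (fun j hj x hx => ?_) h₁ h₂ h₃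
      h₁₂ h₁₃ h₂₃ hθ0.le (fun j => ?_) fun s hs => ?_
    · by_cases hj : j ∈ occ S
      · rw [hXocc j hj] at hx
        rw [hv S hSF j hj]
        exact (Finset.mem_filter.1 hx).2.2
      · rw [hXnot j hj] at hx
        exact (Finset.mem_filter.1 hx).2
    · rw [hXocc j hj] at hx
      exact (Finset.mem_filter.1 hx).2.1
    · by_cases hj : j ∈ occ S
      · rw [hXocc j hj, ← avg_level_mul_card,
          (card_fiber_eq_ker_of_goodFibers ha0 (hyY j hj)).2, ← hm]
        have h5 : a ≤ avg ψ (level f v) (y j) := (Finset.mem_filter.1 (hyY j hj)).2.2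
        calc θ * 2 ^ n ≤ a * κ * 2 ^ n := by gcongr
          _ = a * (κ * 2 ^ n) := by ring
          _ ≤ a * m := by gcongr
          _ ≤ _ := by gcongr
      · rw [hXnot j hj]
        calc θ * 2 ^ n ≤ 1 / t * 2 ^ n := by gcongr
          _ ≤ 1 / t * (t * #{x | f x = S.σ j}) := by gcongr; exact hdense _
          _ = _ := by field_simp
    · rw [hXocc j₁ h₁, hXocc j₂ h₂, hXocc j₃ h₃]
      have key := le_card_triples_goodFibers ψ f v ha0 (y := ![y j₁, y j₂, y j₃])
        (by
          intro i
          fin_cases i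
          · exact hyY j₁ h₁
          · exact hyY j₂ h₂
          · exact hyY j₃ h₃) (s := s) hs
      refine le_trans ?_ key
      calc θ * (2 ^ n) ^ 2 ≤ a ^ 3 / 2 * κ ^ 2 * (2 ^ n) ^ 2 := by gcongr
        _ = a ^ 3 / 2 * (κ * 2 ^ n) ^ 2 := by ring
        _ ≤ a ^ 3 / 2 * m ^ 2 := by gcongr
  · refine Eventually.of_forall fun q n f ψ hirr hYeq _ hfar => ?_
    exfalso
    subst hYeq
    set Y := goodFibers ψ f v (a ^ 3 / 6) a with hY
    set f' : BoolFun n := fun x => if ψ x ∈ Y then f x else !v with hf'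
    have hfree : f' ∈ familyFree F n := by
      rintro S hSF ⟨x, hx⟩
      obtain ⟨hx0, hxσ⟩ := (inducedAt_iff (hF S hSF) _ _).1 hx
      refine hex ⟨S, hSF, fun j => ψ (x j), fun j hj => ?_, ?_⟩
      · have h1 := hxσ j
        rw [hv S hSF j hj] at h1
        by_contra h2
        simp only [hf', h2, if_false] at h1
        exact Bool.not_ne_self v h1
      · rw [← map_sum, hx0, map_zero]
    have h1 := isFar_card (hfar f' hfree)
    have h2 := card_outside_goodFibers_le ψ f v ha0.le hirr
    have hsub : ({x | f x ≠ f' x} : Finset (Cube n)) ⊆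
        ({x | f x = v ∧ ψ x ∉ Y} : Finset (Cube n)) := by
      intro x hx
      simp only [mem_filter, mem_univ, true_and, hf'] at hx ⊢
      by_cases h3 : ψ x ∈ Y
      · simp [h3] at hx
      · simp only [h3, if_false, Bool.ne_not] at hx
        exact ⟨hx, h3⟩
    have h3 : (#{x | f x ≠ f' x} : ℝ) ≤ #{x | f x = v ∧ ψ x ∉ Y} := by
      exact_mod_cast Finset.card_le_card hsub
    have hN : (0 : ℝ) < 2 ^ n := by positivity
    have h4 : ε * 2 ^ n ≤ 2 * a * 2 ^ n := h1.trans (h3.trans h2)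
    have h5 := le_of_mul_le_mul_right h4 hN
    rw [ha] at h5
    linarith

/-! ### Every far function is rejected -/

/-- A triple that shows that `f⁻¹(v)` is not closed under sums of three elements spans a space on
which `f` is nonconstant and violates the conclusion of `exists_closedUnderTriples`. -/
lemma le_rejFrac_three {F : Set InducedSystem} {v : Bool}
    (hv : ∀ (d : ℕ) (h : BoolFun d), h ∈ familyFree F d → (∀ w, ∃ x, h x = w) →
      ClosedUnderTriples h v) {n : ℕ} {f : BoolFun n} {δ : ℝ}
    (hδ : δ * (2 ^ n) ^ 3 ≤ #(badTriples ({x | f x = v} : Finset (Cube n)))) :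
    δ ≤ rejFrac F 3 f := by
  unfold rejFrac
  rw [le_div_iff₀ (by positivity)]
  refine hδ.trans ?_
  have : #(badTriples ({x | f x = v} : Finset (Cube n))) ≤
      #{φ : Fin 3 → Cube n | pull f φ ∉ familyFree F 3} := by
    refine Finset.card_le_card_of_injOn (fun p => ![p.1, p.2.1, p.2.2]) ?_ ?_
    · rintro ⟨x, y, z⟩ hp
      simp only [badTriples, coe_filter, mem_product, mem_filter, mem_univ, true_and,
        Set.mem_ofPred_eq] at hp ⊢
      obtain ⟨⟨hx, hy, hz⟩, hw⟩ := hp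
      intro hfree
      set φ : Fin 3 → Cube n := ![x, y, z] with hφ
      have e0 : pull f φ (Pi.single 0 1) = v := by rw [pull, linComb_single]; exact hx
      have e1 : pull f φ (Pi.single 1 1) = v := by rw [pull, linComb_single]; exact hy
      have e2 : pull f φ (Pi.single 2 1) = v := by rw [pull, linComb_single]; exact hz
      have e3 : pull f φ (Pi.single 0 1 + Pi.single 1 1 + Pi.single 2 1) ≠ v := by
        rw [pull, linComb_add, linComb_add, linComb_single, linComb_single, linComb_single]
        exact hw
      refine e3 (hv 3 _ hfree (fun w => ?_) _ _ _ e0 e1 e2)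
      by_cases hwv : w = v
      · exact ⟨_, e0.trans hwv.symm⟩
      · exact ⟨_, (Bool.eq_not.2 e3).trans (Bool.eq_not.2 hwv).symm⟩
    · rintro ⟨x, y, z⟩ - ⟨x', y', z'⟩ - h
      have h0 := congrFun h 0
      have h1 := congrFun h 1
      have h2 := congrFun h 2
      simp only [Matrix.cons_val] at h0 h1 h2
      rw [h0, h1, h2]
  exact_mod_cast this

lemma rejects_of_nearly_constant {F : Set InducedSystem} {ε : ℝ} {q : ℕ}
    (hq : ∀ (n : ℕ) (f : BoolFun n) (ψ : Cube n →ₗ[ZMod 2] Cube 0) (g : BoolFun 0),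
      IsFarFrom ε (familyFree F) f → (q : ℝ) * #{x | f x ≠ g (ψ x)} ≤ 2 ^ n → Rejects F q f)
    {n : ℕ} {f : BoolFun n} (hf : IsFarFrom ε (familyFree F) f) {w : Bool}
    (hw : ¬(2 : ℝ) ^ n ≤ q * #{x | f x = w}) : Rejects F q f := by
  refine hq n f 0 (fun _ => !w) hf ?_
  simp only [Bool.ne_not]
  exact (not_le.1 hw).le

theorem exists_rejects {F : Set InducedSystem} (hF : ∀ S ∈ F, S.IsSingleEquation) {ε : ℝ}
    (hε : 0 < ε) : ∃ q : ℕ, ∀ (n : ℕ) (f : BoolFun n), IsFarFrom ε (familyFree F) f →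
      Rejects F q f := by
  obtain ⟨t, htJ, ht⟩ :=
    ((eventually_rejects_of_near_junta hF hε 0).and (eventually_gt_atTop 0)).exists
  by_cases hsame : ∃ v, ∀ S ∈ F, ∀ j ∈ occ S, S.σ j = v
  · obtain ⟨v, hv⟩ := hsame
    obtain ⟨q, hq⟩ := (eventually_rejects_of_same_value hF hv hε ht).exists
    refine ⟨max t q, fun n f hfar => ?_⟩
    by_cases hdense : ∀ w, (2 : ℝ) ^ n ≤ t * #{x | f x = w}
    · exact (hq n f hdense hfar).mono (le_max_right _ _)
    · obtain ⟨w, hw⟩ := not_forall.1 hdense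
      exact (rejects_of_nearly_constant htJ hfar hw).mono (le_max_left _ _)
  · push Not at hsame
    obtain ⟨v, hv⟩ := exists_closedUnderTriples hF hsame
    obtain ⟨s, hsJ, hs⟩ :=
      ((eventually_rejects_of_near_junta hF hε (2 * t)).and (eventually_gt_atTop 0)).exists
    obtain ⟨δ, hδ, hA⟩ := exists_affine_of_card_badTriples_le t ht (s := s) (by exact_mod_cast hs)
    obtain ⟨q, hq⟩ := (eventually_rejects F 3 hδ).exists
    refine ⟨max t (max s q), fun n f hfar => ?_⟩
    by_cases hdense : (2 : ℝ) ^ n ≤ t * #{x | f x = v}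
    · by_cases hbad : (#(badTriples ({x | f x = v} : Finset (Cube n))) : ℝ) ≤ δ * (2 ^ n) ^ 3
      · obtain ⟨ψ, w, hψ⟩ := hA n _ hdense hbad
        refine (hsJ n f ψ (fun z => if z = w then v else !v) hfar ?_).mono
          ((le_max_left _ _).trans (le_max_right _ _))
        refine le_trans (le_of_eq ?_) hψ
        congr 3
        ext x
        by_cases h1 : ψ x = w <;> simp [h1]
      · exact (hq n f (le_rejFrac_three hv (not_le.1 hbad).le)).mono
          ((le_max_right _ _).trans (le_max_right _ _))
    · exact (rejects_of_nearly_constant htJ hfar hdense).mono (le_max_left _ _)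

end LinearInvariant


theorem theorem1p3 (F : Set InducedSystem) (hF : ∀ S ∈ F, S.IsSingleEquation) :
    IsTestableOneSided (familyFree F) :=
  LinearInvariant.isTestableOneSided_of_rejects F fun _ hε =>
    LinearInvariant.exists_rejects hF hε
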